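/- Let $\Gamma$ be a finite group, $\Gamma_*$ its set of conjugacy classes, $c^0\in\Gamma_*$ the class of $1$, and $\Gamma_n=\Gamma^n\rtimes S_n$ with $(g,\sigma)(h,\tau)=(g\,\sigma(h),\sigma\tau)$, $\sigma(h)_i=h_{\sigma^{-1}(i)}$. Let $\mathcal P(\Gamma_*)$ be the set of functions $\lambda=(\lambda(c))_{c\in\Gamma_*}$ from $\Gamma_*$ to partitions, $\|\lambda\|=\sum_c|\lambda(c)|$, and for $r\ge1$, $c\in\Gamma_*$ let $(r)_c$ be the function with value the one-part partition $(r)$ at $c$ and $\emptyset$ elsewhere. The modified type of $x=(g,\sigma)\in\Gamma_n$ is the $\rho\in\mathcal P(\Gamma_*)$ such that, for $c\ne c^0$, the parts of $\rho(c)$ are the lengths of the cycles $(i_1\cdots i_k)$ of $\sigma$ with cycle-product $g_{i_k}\cdots g_{i_1}\in c$, and the parts of $\rho(c^0)$ are the nonzero numbers $k-1$, for $k$ running over the lengths of the cycles of $\sigma$ with cycle-product $1$. Let $K_\lambda(n)\in\mathbb Z[\Gamma_n]$ be the sum of the elements of modified type $\lambda$, and let $a_{\lambda\mu}^{\nu}(n)$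 be the coefficient of $K_\nu(n)$ in $K_\lambda(n)K_\mu(n)$ (for $K_\nu(n)\neq0$, i.e. $n\ge\|\nu\|+\ell(\nu(c^0))$). Let $\mathcal G_\Gamma$ be the free abelian group with basis $(K_\lambda)_{\lambda\in\mathcal P(\Gamma_*)}$ and the bilinear multiplication $$K_\lambda K_\mu=\sum_{\|\nu\|=\|\lambda\|+\|\mu\|}a_{\lambda\mu}^{\nu}K_\nu,\qquad a_{\lambda\mu}^\nu=a_{\lambda\mu}^\nu\bigl(\|\nu\|+\ell(\nu(c^0))\bigr).$$ Let $\ge$ be the partial order on $\mathcal P(\Gamma_*)$ generated (as reflexive transitive closure) by the following relations $\mu\ge\lambda$ between elements with $\|\lambda\|=\|\mu\|$: (i) the multiset of parts of $\mu(c^0)$ is strictly contained in that of $\lambda(c^0)$; (ii) for every $c\in\Gamma_*$, $|\mu(c)|=|\lambda(c)|$ and $\mu(c)$ dominates $\lambda(c)$. Theorem. If $\|\nu\|=\|\lambda\|+\|\mu\|$, then $a_{\lambda\mu}^{\nu}(n)=a_{\lambda\mu}^\nu$ for every $n$ with $K_\nu(n)\ne0$, and $\mathcal G_\Gamma$ is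 a commutative (associative, unital) ring, the Farahat--Higman ring. For every $\lambda\in\mathcal P(\Gamma_*)$, with $\lambda(c)=(\lambda_1(c),\lambda_2(c),\dots)$, $$\prod_{c\in\Gamma_*}K_{(\lambda_1(c))_c}K_{(\lambda_2(c))_c}\cdots=\sum_{\mu\ge\lambda}d_{\lambda\mu}K_\mu$$ in $\mathcal G_\Gamma$, with $d_{\lambda\mu}\in\mathbb Z_{\ge0}$ and $d_{\lambda\lambda}>0$. The elements $K_{(r)_c}$ ($r\ge1$, $c\in\Gamma_*$) of $\mathcal G_\Gamma$ are algebraically independent over $\mathbb Z$; their images in $\mathbb Q\otimes_{\mathbb Z}\mathcal G_\Gamma$ are algebraically independent over $\mathbb Q$ and generate this $\mathbb Q$-algebra, which is therefore the polynomial ring in them. -/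

import Mathlib

open scoped TensorProduct

noncomputable section

/-! ### Partitions and partition-valued functions -/

/-- A partition, as the multiset of its parts. -/
abbrev Partn : Type := Multiset ℕ+

namespace Partn

/-- `|α|`, the sum of the parts. -/
def size (α : Partn) : ℕ := (α.map (fun r : ℕ+ => (r : ℕ))).sum

/-- `α₁ + ⋯ + α_k`, the sum of the `k` largest parts. -/
def partialSum (α : Partn) (k : ℕ) : ℕ :=
  (((α.map (fun r : ℕ+ => (r : ℕ))).sort (· ≥ ·)).take k).sum

/-- `Dominates β α` : the partitions have the same size and `β ≥ α` in the dominance order. -/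
def Dominates (β α : Partn) : Prop :=
  α.size = β.size ∧ ∀ k, α.partialSum k ≤ β.partialSum k

end Partn

/-- Partition-valued functions on the set `Γ_*` of conjugacy classes of `Γ`. -/
@[ext] structure PartFn (Γ : Type*) [Group Γ] where
  /-- the partition attached to a conjugacy class -/
  part : ConjClasses Γ → Partn

namespace PartFn

variable {Γ : Type*} [Group Γ]

/-- `‖ρ‖ = ∑_c |ρ(c)|` (a finite sum when `Γ` is finite). -/
def degree (ρ : PartFn Γ) : ℕ := ∑ᶠ c, (ρ.part c).size

open Classical in
/-- `(r)_c` : the partition `(r)` at `c`, and the empty partition elsewhere. -/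
def single (c : ConjClasses Γ) (r : ℕ+) : PartFn Γ :=
  ⟨fun c' => if c' = c then {r} else 0⟩

/-- The relation generating the partial order: `lam` and `mu` have the same degree, and either the
parts of `mu(c⁰)` form a proper sub-multiset of the parts of `lam(c⁰)`, or `mu(c)` and `lam(c)`
have the same size and `mu(c)` dominates `lam(c)`, for every class `c`. -/
def Step (lam mu : PartFn Γ) : Prop :=
  lam.degree = mu.degree ∧
    (mu.part (ConjClasses.mk 1) < lam.part (ConjClasses.mk 1) ∨
      ∀ c, (mu.part c).Dominates (lam.part c))

end PartFn

theorem Partn.size_lt_of_lt {α β : Partn} (h : α < β) : α.size < β.size := by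
  obtain ⟨γ, rfl⟩ := Multiset.le_iff_exists_add.1 h.le
  have hγ : γ ≠ 0 := by
    rintro rfl
    simp at h
  obtain ⟨r, hr⟩ := Multiset.exists_mem_of_ne_zero hγ
  obtain ⟨δ, rfl⟩ := Multiset.exists_cons_of_mem hr
  have := r.pos
  simp only [Partn.size, Multiset.map_add, Multiset.map_cons, Multiset.sum_add,
    Multiset.sum_cons]
  omega

theorem List.eq_of_take_sum {l m : List ℕ} (hl : ∀ a ∈ l, 0 < a) (hm : ∀ a ∈ m, 0 < a)
    (h : ∀ k, (l.take k).sum = (m.take k).sum) : l = m := by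
  induction l generalizing m with
  | nil =>
    cases m with
    | nil => rfl
    | cons b m =>
      have h1 := h 1
      have := hm b (by simp)
      simp at h1
      omega
  | cons a l ih =>
    cases m with
    | nil =>
      have h1 := h 1
      have := hl a (by simp)
      simp at h1
      omega
    | cons b m =>
      have h1 : a = b := by simpa using h 1
      subst h1
      congr 1
      refine ih (fun x hx => hl x (by simp [hx])) (fun x hx => hm x (by simp [hx])) fun k => ?_
      simpa using h (k + 1)

theorem Partn.eq_of_partialSum {α β : Partn} (h : ∀ k, α.partialSum k = β.partialSum k) :
    α = β := by
  have hpos : ∀ (γ : Partn), ∀ a ∈ (γ.map (fun r : ℕ+ => (r : ℕ))).sort (· ≥ ·), 0 < a := by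
    intro γ a ha
    rw [Multiset.mem_sort, Multiset.mem_map] at ha
    obtain ⟨r, -, rfl⟩ := ha
    exact r.pos
  have h1 := List.eq_of_take_sum (hpos α) (hpos β) h
  have h2 := congrArg (fun l : List ℕ => (l : Multiset ℕ)) h1
  simp only [Multiset.sort_eq] at h2
  exact Multiset.map_injective PNat.coe_injective h2

namespace PartFn

variable {Γ : Type*} [Group Γ]

theorem antisymm_aux {lam mu : PartFn Γ} (h : Relation.ReflTransGen Step lam mu) :
    (mu.part (ConjClasses.mk 1)).size < (lam.part (ConjClasses.mk 1)).size ∨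
      ((mu.part (ConjClasses.mk 1)).size = (lam.part (ConjClasses.mk 1)).size ∧
        ∀ c, (mu.part c).Dominates (lam.part c)) := by
  induction h with
  | refl => exact Or.inr ⟨rfl, fun c => ⟨rfl, fun k => le_rfl⟩⟩
  | tail _ hs ih =>
    rcases hs.2 with h1 | h1
    · have := Partn.size_lt_of_lt h1
      rcases ih with h2 | h2
      · left; omega
      · left; omega
    · have h3 := (h1 (ConjClasses.mk 1)).1
      rcases ih with h2 | ⟨h2, h4⟩
      · left; omega
      · right
        exact ⟨by omega, fun c => ⟨(h4 c).1.trans (h1 c).1,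
          fun k => ((h4 c).2 k).trans ((h1 c).2 k)⟩⟩

/-- The partial order on partition-valued functions generated by `Step`; comparable elements have
the same degree. -/
instance : PartialOrder (PartFn Γ) where
  le lam mu := Relation.ReflTransGen Step lam mu
  le_refl _ := Relation.ReflTransGen.refl
  le_trans _ _ _ := Relation.ReflTransGen.trans
  le_antisymm lam mu h1 h2 := by
    rcases antisymm_aux h1 with h3 | ⟨h3, h4⟩ <;> rcases antisymm_aux h2 with h5 | ⟨h5, h6⟩
    · omega
    · omega
    · omega
    · ext1
      funext c
      exact Partn.eq_of_partialSum fun k => le_antisymm ((h4 c).2 k) ((h6 c).2 k)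

theorem finite_degree [Finite Γ] (d : ℕ) : {ρ : PartFn Γ | ρ.degree = d}.Finite := by
  have hfin : {α : Partn | α.size ≤ d}.Finite := by
    have : {α : Partn | α.size ≤ d} ⊆
        ⋃ e ∈ Set.Iic d, (fun α : Partn => α.map (fun r : ℕ+ => (r : ℕ))) ⁻¹'
          Set.range (fun p : Nat.Partition e => p.parts) := by
      intro α hα
      simp only [Set.mem_iUnion]
      refine ⟨α.size, hα, ⟨⟨α.map (fun r : ℕ+ => (r : ℕ)), ?_, rfl⟩, rfl⟩⟩
      intro a ha
      rw [Multiset.mem_map] at ha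
      obtain ⟨r, -, rfl⟩ := ha
      exact r.pos
    refine Set.Finite.subset (Set.Finite.biUnion (Set.finite_Iic d) fun e _ => ?_) this
    exact (Set.finite_range _).preimage (Multiset.map_injective PNat.coe_injective).injOn
  have hpi : (Set.pi Set.univ fun _ : ConjClasses Γ => {α : Partn | α.size ≤ d}).Finite :=
    Set.Finite.pi fun _ => hfin
  refine (hpi.preimage (f := PartFn.part) fun a _ b _ h => PartFn.ext h).subset ?_
  intro ρ hρ c _
  have h1 : (ρ.part c).size ≤ ∑ᶠ c, (ρ.part c).size :=
    single_le_finsum (f := fun c => (ρ.part c).size) c (Set.toFinite _) fun _ => Nat.zero_le _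
  exact h1.trans (le_of_eq hρ)

/-- The finite set `𝒫_d(Γ_*)` of partition-valued functions of degree `d`. -/
def ofDegree (Γ : Type*) [Group Γ] [Finite Γ] (d : ℕ) : Finset (PartFn Γ) :=
  (finite_degree (Γ := Γ) d).toFinset

end PartFn

/-! ### Wreath products and modified types -/

/-- `Γ_n = Γⁿ ⋊ S_n` with `(g, σ)(h, τ) = (g σ(h), στ)`, where `σ(h)_i = h_{σ⁻¹(i)}`. -/
abbrev Wreath (Γ : Type*) [Group Γ] (n : ℕ) : Type _ :=
  (Fin n → Γ) ⋊[mulAutArrow] Equiv.Perm (Fin n)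

instance Wreath.instFinite (Γ : Type*) [Group Γ] [Finite Γ] (n : ℕ) : Finite (Wreath Γ n) :=
  Finite.of_equiv _ SemidirectProduct.equivProd.symm

namespace Wreath

variable {Γ : Type*} [Group Γ] {n : ℕ}

/-- Length of the cycle of the permutation part of `x` through `i`. -/
def cycleLength (x : Wreath Γ n) (i : Fin n) : ℕ := Function.minimalPeriod x.right i

/-- The class of the cycle-product `g_{i_k} ⋯ g_{i_1}` of the cycle `(i_1 ⋯ i_k)` of `x = (g, σ)`
with `i_k = i`; this product is the `i`-th coordinate of the `Γⁿ`-part of `x ^ k`. -/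
def cycleClass (x : Wreath Γ n) (i : Fin n) : ConjClasses Γ :=
  ConjClasses.mk ((x ^ x.cycleLength i).left i)

open Classical in
/-- The type of `x` at `c`: the lengths of the cycles of `x` whose cycle-product lies in `c`.
Each cycle is represented by its least element. -/
def cycleLengths (x : Wreath Γ n) (c : ConjClasses Γ) : Multiset ℕ :=
  (Finset.univ.filter fun i : Fin n =>
    (∀ j, x.right.SameCycle i j → i ≤ j) ∧ x.cycleClass i = c).val.map x.cycleLength

open Classical in
/-- The modified type of `x`: at the class of `1` every part of the type is lowered by one,
and zero parts are dropped. -/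
def modifiedType (x : Wreath Γ n) : PartFn Γ :=
  ⟨fun c => ((x.cycleLengths c).map fun k => if c = ConjClasses.mk 1 then k - 1 else k).filterMap
    fun k => if h : 0 < k then some ⟨k, h⟩ else none⟩

variable [Finite Γ]

open Classical in
/-- `K_lam(n)` in the group ring `ℤ[Γ_n]`: the sum of all elements of `Γ_n` of modified type
`lam`. -/
def classSum (n : ℕ) (lam : PartFn Γ) : MonoidAlgebra ℤ (Wreath Γ n) :=
  MonoidAlgebra.ofCoeff
    (Finsupp.equivFunOnFinite.symm fun x => if x.modifiedType = lam then 1 else 0)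

open Classical in
/-- The coefficient of `K_nu(n)` in `K_lam(n) K_mu(n)`, i.e. the coefficient of any element of
modified type `nu`; it is set to `0` if `K_nu(n) = 0`. -/
def classConst (n : ℕ) (lam mu nu : PartFn Γ) : ℤ :=
  if h : ∃ z : Wreath Γ n, z.modifiedType = nu then
    (classSum n lam * classSum n mu).coeff h.choose
  else 0

end Wreath

/-! ### The Farahat-Higman ring -/

/-- The free abelian group with basis `K_lam`, for `lam` a partition-valued function on `Γ_*`. -/
def FHRing (Γ : Type*) [Group Γ] : Type _ := PartFn Γ →₀ ℤ

namespace FHRing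

variable {Γ : Type*} [Group Γ]

/-- The basis element `K_lam`. -/
def K (lam : PartFn Γ) : FHRing Γ := Finsupp.single lam (1 : ℤ)

/-- The additive group structure of the free abelian group. -/
abbrev addCommGroup (Γ : Type*) [Group Γ] : AddCommGroup (FHRing Γ) :=
  inferInstanceAs (AddCommGroup (PartFn Γ →₀ ℤ))

variable [Finite Γ]

/-- The structure constant `a_{lam mu}^nu`, for `‖nu‖ = ‖lam‖ + ‖mu‖`: the coefficient of `K_nu(n)`
in `K_lam(n) K_mu(n)` for `n = ‖nu‖ + ℓ(nu(c⁰))`, the least `n` with `K_nu(n) ≠ 0`. -/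
def const (lam mu nu : PartFn Γ) : ℤ :=
  Wreath.classConst (nu.degree + Multiset.card (nu.part (ConjClasses.mk 1))) lam mu nu

/-- `K_lam K_mu = ∑ a_{lam mu}^nu K_nu`, over all `nu` with `‖nu‖ = ‖lam‖ + ‖mu‖`. -/
def basisMul (lam mu : PartFn Γ) : PartFn Γ →₀ ℤ :=
  ∑ nu ∈ PartFn.ofDegree Γ (lam.degree + mu.degree), Finsupp.single nu (const lam mu nu)

/-- The bilinear extension of `basisMul`. -/
def mulHom (Γ : Type*) [Group Γ] [Finite Γ] :
    (PartFn Γ →₀ ℤ) →ₗ[ℤ] (PartFn Γ →₀ ℤ) →ₗ[ℤ] (PartFn Γ →₀ ℤ) :=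
  Finsupp.linearCombination ℤ fun lam => Finsupp.linearCombination ℤ fun mu => basisMul lam mu

/-- The addition and multiplication of `𝒢_Γ`. -/
abbrev addMul (Γ : Type*) [Group Γ] [Finite Γ] : NonUnitalNonAssocRing (FHRing Γ) :=
  letI := addCommGroup Γ
  { addCommGroup Γ with
    mul := fun f g => mulHom Γ f g
    left_distrib := fun a b c => map_add (mulHom Γ a) b c
    right_distrib := fun a b c => LinearMap.map_add₂ (mulHom Γ) a b c
    zero_mul := fun a => LinearMap.map_zero₂ (mulHom Γ) a
    mul_zero := fun a => map_zero (mulHom Γ a) }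

end FHRing

end

/-! The theorem rests on reading the degree as a codimension. The group `Γ_n` acts on functions `f :
[n] → Γ ∪ {0}`; an element `x` fixes `f` when `f (x i) = gain x i * f i` for all `i`. Put `q = |Γ| +
1` and call a cycle balanced if its cycle-product is trivial. A fixed function vanishes on the
unbalanced cycles and is determined on a balanced one by a single value, which is arbitrary, so `x`
fixes `q ^ b` functions, `b` being the number of balanced cycles. On the other hand `‖type x‖ = n -
b` (`degree_modifiedType_add_card`).

Adding one edge equation divides the number of solutions by at most `q` (`card_flat_le_insert`).
Since `Fix x ∩ Fix y ⊆ Fix (x * y)`, the degree is subadditive, and when the degrees add up the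
inclusion is an equality (`fixSet_mul_eq`). Then a point fixed with trivial coefficient by `x * y`
is so fixed by `x` and by `y`. A top-degree factorization of `z ⊕ 1` therefore lives on the points
of `z`, and the number of such factorizations does not depend on `n` (`numFact_eq`). The product on
`FHRing Γ` is the top-degree part of multiplication of class sums in `ℤ[Γ_n]`, from which it
inherits associativity and commutativity.

Triangularity comes from multiplying by one cycle `x` (`single_add_le_modifiedType_mul`). In top
degree, on the orbit `O` of that cycle under `x` and `y`, a function fixed by `x * y` is fixed by
both factors, hence nowhere zero on `O` or identically zero there. In the first case everything on
`O` is balanced and `x * y` is one cycle there, so its one part dominates the parts of the factors.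
In the second case `x * y` has no balanced cycle on `O`, so parts at `c⁰` are lost, or there were
none and the type is unchanged. The coefficient of the union of the types is positive because of
direct sums (`basisMul_add_pos`).

Monomials in the `K_{(r)_c}` and basis elements are both indexed by multisets of pairs `(c, r)`.
Triangularity then gives algebraic independence by a minimal monomial, and generation over `ℚ` by a
maximal counterexample inside a fixed degree, where there are finitely many indices. -/

noncomputable section

/-! ### Dominance order on multisets of parts -/

namespace Partn

@[simp] theorem size_zero : size 0 = 0 := rfl

@[simp] theorem size_add (α β : Partn) : (α + β).size = α.size + β.size := by
  simp [size]

@[simp] theorem size_singleton (r : ℕ+) : size {r} = r := by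
  simp [size]

end Partn

theorem List.multiset_sum_le_take_sum {l : List ℕ} (hl : l.Pairwise (· ≥ ·)) {T : Multiset ℕ}
    (hT : T ≤ l) {k : ℕ} (hk : Multiset.card T ≤ k) : T.sum ≤ (l.take k).sum := by
  induction l generalizing T k with
  | nil =>
    have : T = 0 := by simpa using hT
    simp [this]
  | cons a l ih =>
    rw [List.pairwise_cons] at hl
    rcases Multiset.empty_or_exists_mem T with rfl | ⟨b, hb⟩
    · simp
    · cases k with
      | zero => simp at hk; simp [hk] at hb
      | succ k =>
        rw [List.take_succ_cons, List.sum_cons]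
        rw [← Multiset.cons_coe] at hT
        by_cases ha : a ∈ T
        · obtain ⟨T', rfl⟩ := Multiset.exists_cons_of_mem ha
          have := ih hl.2 ((Multiset.cons_le_cons_iff a).1 hT) (k := k) (by simpa using hk)
          simpa using this
        -- Exchange: the head `a` is missing from `T`, so some `b` in `T` is traded for it, and `b ≤
        -- a` because the list is decreasing.
        · have hT' : T ≤ l := (Multiset.le_cons_of_notMem ha).1 hT
          have hba : b ≤ a := hl.1 b (by simpa using Multiset.mem_of_le hT' hb)
          obtain ⟨T', rfl⟩ := Multiset.exists_cons_of_mem hb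
          have := ih hl.2 ((Multiset.le_cons_self T' b).trans hT') (k := k) (by simpa using hk)
          simp only [Multiset.sum_cons]
          omega

namespace Partn

theorem size_le_partialSum {α T : Partn} (hT : T ≤ α) {k : ℕ} (hk : Multiset.card T ≤ k) :
    T.size ≤ α.partialSum k := by
  refine List.multiset_sum_le_take_sum (Multiset.pairwise_sort _ _) ?_ (by simpa using hk)
  rw [Multiset.sort_eq]
  exact Multiset.map_le_map hT

theorem exists_size_eq_partialSum (α : Partn) (k : ℕ) :
    ∃ T ≤ α, Multiset.card T ≤ k ∧ T.size = α.partialSum k := by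
  set l := (α.map (fun r : ℕ+ => (r : ℕ))).sort (· ≥ ·) with hl
  have h1 : ((l.take k : List ℕ) : Multiset ℕ) ≤ α.map (fun r : ℕ+ => (r : ℕ)) := by
    rw [← Multiset.sort_eq (α.map (fun r : ℕ+ => (r : ℕ))) (· ≥ ·)]
    exact (List.take_sublist k l).subperm
  obtain ⟨T, hT, h2⟩ : ∃ T ≤ α, T.map (fun r : ℕ+ => (r : ℕ)) = (l.take k : List ℕ) := by
    refine ⟨((l.take k : List ℕ) : Multiset ℕ).map Nat.toPNat', ?_, ?_⟩
    · have := Multiset.map_le_map (f := Nat.toPNat') h1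
      simpa only [Multiset.map_map, Function.comp_def, PNat.coe_toPNat', Multiset.map_id'] using this
    · rw [Multiset.map_map]
      conv_rhs => rw [← Multiset.map_id' ((l.take k : List ℕ) : Multiset ℕ)]
      refine Multiset.map_congr rfl fun a ha => ?_
      obtain ⟨r, -, rfl⟩ := Multiset.mem_map.1 (Multiset.mem_of_le h1 ha)
      simp
  refine ⟨T, hT, ?_, ?_⟩
  · have := congrArg Multiset.card h2
    simp only [Multiset.card_map, Multiset.coe_card, List.length_take] at this
    omega
  · simp [size, h2, partialSum, ← hl]

/-- The sum of the `k` largest parts is the maximum of the sums over sub-multisets with at most `k`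
elements. In this form no sorting occurs, and compatibility with unions reduces to splitting a
sub-multiset of a union. -/
theorem dominates_iff {β α : Partn} : β.Dominates α ↔ α.size = β.size ∧
    ∀ T ≤ α, ∃ U ≤ β, Multiset.card U ≤ Multiset.card T ∧ T.size ≤ U.size := by
  refine and_congr Iff.rfl ⟨fun h T hT => ?_, fun h k => ?_⟩
  · obtain ⟨U, hU, h1, h2⟩ := exists_size_eq_partialSum β (Multiset.card T)
    exact ⟨U, hU, h1, h2 ▸ (size_le_partialSum hT le_rfl).trans (h _)⟩
  · obtain ⟨T, hT, h1, h2⟩ := exists_size_eq_partialSum α k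
    obtain ⟨U, hU, h3, h4⟩ := h T hT
    exact h2 ▸ h4.trans (size_le_partialSum hU (h3.trans h1))

theorem Dominates.rfl {α : Partn} : α.Dominates α := ⟨Eq.refl _, fun _ => le_rfl⟩

theorem _root_.Multiset.exists_add_of_le_add {ι : Type*} {s t u : Multiset ι} (h : u ≤ s + t) :
    ∃ v ≤ s, ∃ w ≤ t, u = v + w := by
  classical
  refine ⟨u ∩ s, Multiset.inter_le_right, u - u ∩ s, ?_, ?_⟩
  · rw [Multiset.le_iff_count]
    intro a
    have := Multiset.le_iff_count.1 h a
    simp only [Multiset.count_sub, Multiset.count_inter, Multiset.count_add] at *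
    omega
  · rw [add_tsub_cancel_of_le Multiset.inter_le_left]

theorem Dominates.add {β α δ γ : Partn} (h1 : β.Dominates α) (h2 : δ.Dominates γ) :
    (β + δ).Dominates (α + γ) := by
  rw [dominates_iff] at *
  refine ⟨by simp [h1.1, h2.1], fun T hT => ?_⟩
  obtain ⟨V, hV, W, hW, rfl⟩ := Multiset.exists_add_of_le_add hT
  obtain ⟨V', hV', h3, h4⟩ := h1.2 V hV
  obtain ⟨W', hW', h5, h6⟩ := h2.2 W hW
  exact ⟨V' + W', add_le_add hV' hW', by simpa using add_le_add h3 h5,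
    by simpa using add_le_add h4 h6⟩

theorem dominates_singleton {r : ℕ+} {α : Partn} (h : α.size = r) : Dominates {r} α := by
  rw [dominates_iff]
  refine ⟨by simp [h], fun T hT => ?_⟩
  rcases Multiset.empty_or_exists_mem T with rfl | ⟨b, hb⟩
  · exact ⟨0, by simp, by simp, by simp⟩
  · refine ⟨{r}, le_rfl, ?_, ?_⟩
    · exact Multiset.card_pos_iff_exists_mem.2 ⟨b, hb⟩
    · rw [size_singleton, ← h]
      obtain ⟨U, rfl⟩ := Multiset.le_iff_exists_add.1 hT
      simp

end Partn

/-! ### The monoid of partition-valued functions, free on the `(r)_c` -/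

namespace PartFn

variable {Γ : Type*} [Group Γ]

/-- Partition-valued functions, as functions. -/
def equivFun : PartFn Γ ≃ (ConjClasses Γ → Partn) := ⟨part, mk, fun _ => rfl, fun _ => rfl⟩

/-- Addition is the union of the multisets of parts. -/
instance : AddCommMonoid (PartFn Γ) := equivFun.addCommMonoid

@[simp] theorem zero_part (c : ConjClasses Γ) : (0 : PartFn Γ).part c = 0 := rfl

@[simp] theorem add_part (lam mu : PartFn Γ) (c : ConjClasses Γ) :
    (lam + mu).part c = lam.part c + mu.part c := rfl

/-- `part` at a class, as an additive map. -/
def partHom (c : ConjClasses Γ) : PartFn Γ →+ Partn where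
  toFun lam := lam.part c
  map_zero' := rfl
  map_add' _ _ := rfl

theorem sum_part {ι : Type*} (s : Finset ι) (f : ι → PartFn Γ) (c : ConjClasses Γ) :
    (∑ i ∈ s, f i).part c = ∑ i ∈ s, (f i).part c :=
  map_sum (partHom c) f s

@[simp] theorem single_part_self (c : ConjClasses Γ) (r : ℕ+) : (single c r).part c = {r} := by
  simp [single]

theorem single_part_of_ne {c c' : ConjClasses Γ} (h : c' ≠ c) (r : ℕ+) :
    (single c r).part c' = 0 := by
  simp [single, h]

@[simp] theorem degree_zero : degree (0 : PartFn Γ) = 0 := by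
  simp [degree]

@[simp] theorem degree_single (c : ConjClasses Γ) (r : ℕ+) : degree (single c r) = r := by
  rw [degree, finsum_eq_single _ c fun c' h => by simp [single_part_of_ne h]]
  simp

theorem Step.le {lam mu : PartFn Γ} (h : Step lam mu) : lam ≤ mu :=
  Relation.ReflTransGen.single h

theorem degree_eq_of_le {lam mu : PartFn Γ} (h : lam ≤ mu) : lam.degree = mu.degree := by
  change Relation.ReflTransGen Step lam mu at h
  induction h with
  | refl => rfl
  | tail _ h ih => exact ih.trans h.1

/-- The partition-valued function with a given multiset of parts. -/
def ofParts (Γ : Type*) [Group Γ] : Multiset (ConjClasses Γ × ℕ+) →+ PartFn Γ where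
  toFun M := (M.map fun p => single p.1 p.2).sum
  map_zero' := rfl
  map_add' := by simp

theorem ofParts_apply (M : Multiset (ConjClasses Γ × ℕ+)) :
    ofParts Γ M = (M.map fun p => single p.1 p.2).sum := rfl

theorem ofParts_cons (p : ConjClasses Γ × ℕ+) (M : Multiset (ConjClasses Γ × ℕ+)) :
    ofParts Γ (p ::ₘ M) = single p.1 p.2 + ofParts Γ M := by
  simp [ofParts_apply]

open Classical in
theorem count_ofParts (M : Multiset (ConjClasses Γ × ℕ+)) (c : ConjClasses Γ) (r : ℕ+) :
    ((ofParts Γ M).part c).count r = Multiset.countP (fun p => p = (c, r)) M := by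
  induction M using Multiset.induction_on with
  | empty => simp
  | cons p M ih =>
    obtain ⟨c', r'⟩ := p
    rw [ofParts_cons, add_part, Multiset.count_add, ih, Multiset.countP_cons, add_comm]
    congr 1
    by_cases hc : c' = c
    · subst hc
      simp [Multiset.count_singleton, eq_comm]
    · rw [single_part_of_ne (Ne.symm hc)]
      simp [hc]

theorem ofParts_injective : Function.Injective (ofParts Γ) := by
  classical
  intro M N h
  ext ⟨c, r⟩
  have := count_ofParts M c r
  rw [h, count_ofParts] at this
  simpa [Multiset.count, eq_comm] using this.symm

theorem ofParts_sum_map [Fintype (ConjClasses Γ)] (lam : PartFn Γ) :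
    ofParts Γ (∑ c, (lam.part c).map fun r => (c, r)) = lam := by
  ext c : 2
  rw [map_sum, sum_part, Finset.sum_eq_single c]
  · generalize lam.part c = α
    induction α using Multiset.induction_on with
    | empty => simp
    | cons r α ih => rw [Multiset.map_cons, ofParts_cons, add_part, ih, single_part_self]; rfl
  · intro c' _ hc
    generalize lam.part c' = α
    induction α using Multiset.induction_on with
    | empty => simp
    | cons r α ih =>
      rw [Multiset.map_cons, ofParts_cons, add_part, ih, single_part_of_ne hc.symm]; rfl
  · simp

variable [Finite Γ]

@[simp] theorem degree_add (lam mu : PartFn Γ) : degree (lam + mu) = degree lam + degree mu := by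
  simp only [degree, add_part, Partn.size_add]
  exact finsum_add_distrib (Set.toFinite _) (Set.toFinite _)

/-- The degree, as an additive map. -/
def degreeHom (Γ : Type*) [Group Γ] [Finite Γ] : PartFn Γ →+ ℕ where
  toFun := degree
  map_zero' := degree_zero
  map_add' := degree_add

theorem degree_sum {ι : Type*} (s : Finset ι) (f : ι → PartFn Γ) :
    degree (∑ i ∈ s, f i) = ∑ i ∈ s, degree (f i) :=
  map_sum (degreeHom Γ) f s

@[simp] theorem mem_ofDegree {d : ℕ} {lam : PartFn Γ} : lam ∈ ofDegree Γ d ↔ lam.degree = d := by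
  simp [ofDegree]

theorem Step.add_right {lam mu : PartFn Γ} (h : Step lam mu) (rho : PartFn Γ) :
    Step (lam + rho) (mu + rho) := by
  refine ⟨by simp [h.1], h.2.imp (fun h => ?_) fun h c => ?_⟩
  · simpa using h
  · exact (h c).add .rfl

/-- Both generating relations survive the union with `rho`. This allows triangularity to be proved
one factor at a time, and an inequality on one orbit to be extended by the untouched cycles. -/
theorem add_le_add_right' {lam mu : PartFn Γ} (h : lam ≤ mu) (rho : PartFn Γ) :
    lam + rho ≤ mu + rho := by
  change Relation.ReflTransGen Step lam mu at h
  induction h with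
  | refl => exact le_rfl
  | tail _ h ih => exact ih.trans (h.add_right rho).le

theorem ofParts_surjective : Function.Surjective (ofParts Γ) := by
  have := Fintype.ofFinite (ConjClasses Γ)
  exact fun lam => ⟨_, ofParts_sum_map lam⟩

end PartFn

/-- The partition with the single part `k`, which is empty for `k = 0`. -/
def Partn.ofNat (k : ℕ) : Partn := if 0 < k then {k.toPNat'} else 0

@[simp] theorem Partn.size_ofNat (k : ℕ) : (Partn.ofNat k).size = k := by
  by_cases h : 0 < k
  · simp [Partn.ofNat, h]
  · obtain rfl : k = 0 := by omega
    simp [Partn.ofNat]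

theorem Partn.ofNat_coe (r : ℕ+) : Partn.ofNat r = {r} := by
  simp [Partn.ofNat]

@[simp] theorem Partn.ofNat_zero : Partn.ofNat 0 = 0 := by
  simp [Partn.ofNat]

/-! ### Wreath products in gain coordinates -/

namespace Wreath

variable {Γ : Type*} [Group Γ] {m n : ℕ}

theorem ext_iff_right_left {x y : Wreath Γ n} :
    x = y ↔ (∀ i, x.right i = y.right i) ∧ ∀ i, x.left i = y.left i := by
  refine ⟨by rintro rfl; simp, fun h => SemidirectProduct.ext (funext h.2) (Equiv.ext h.1)⟩

/-- The coefficient of `x` on the arrow from `i` to `x.right i`. -/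
def gain (x : Wreath Γ n) (i : Fin n) : Γ := x.left (x.right i)

-- Indexing a coefficient by the source of its arrow turns the semidirect product rule into
-- composition along the path `i → y i → x (y i)`, without inverse permutations.
@[simp] theorem gain_mul (x y : Wreath Γ n) (i : Fin n) :
    gain (x * y) i = gain x (y.right i) * gain y i := by
  change x.left _ * y.left (x.right⁻¹ (x.right (y.right i))) = _
  simp [gain]

@[simp] theorem gain_one (i : Fin n) : gain (1 : Wreath Γ n) i = 1 := rfl

@[simp] theorem right_pow (x : Wreath Γ n) (k : ℕ) : (x ^ k).right = x.right ^ k :=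
  map_pow (SemidirectProduct.rightHom (φ := mulAutArrow)) x k

@[simp] theorem right_zpow (x : Wreath Γ n) (k : ℤ) : (x ^ k).right = x.right ^ k :=
  map_zpow (SemidirectProduct.rightHom (φ := mulAutArrow)) x k

theorem ext_gain {x y : Wreath Γ n} (h1 : ∀ i, x.right i = y.right i)
    (h2 : ∀ i, gain x i = gain y i) : x = y := by
  refine ext_iff_right_left.2 ⟨h1, fun i => ?_⟩
  have := h2 (x.right⁻¹ i)
  unfold gain at this
  rw [← h1] at this
  simpa using this

/-- The element with prescribed permutation part and gains. -/
def ofGain (σ : Equiv.Perm (Fin n)) (g : Fin n → Γ) : Wreath Γ n := ⟨fun i => g (σ⁻¹ i), σ⟩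

@[simp] theorem right_ofGain (σ : Equiv.Perm (Fin n)) (g : Fin n → Γ) :
    (ofGain σ g).right = σ := rfl

@[simp] theorem gain_ofGain (σ : Equiv.Perm (Fin n)) (g : Fin n → Γ) (i : Fin n) :
    gain (ofGain σ g) i = g i := by
  simp [gain, ofGain]

/-! ### Intertwiners -/

/-- The map `(i, a) ↦ (φ i, u i * a)` carries the action of `x` to that of `z`. -/
def Intertwines (φ : Fin m → Fin n) (u : Fin m → Γ) (x : Wreath Γ m) (z : Wreath Γ n) : Prop :=
  ∀ i, z.right (φ i) = φ (x.right i) ∧ gain z (φ i) * u i = u (x.right i) * gain x i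

namespace Intertwines

variable {φ : Fin m → Fin n} {u : Fin m → Γ} {x x' : Wreath Γ m} {z z' : Wreath Γ n}

theorem one : Intertwines φ u 1 1 := fun i => by simp

theorem mul (h : Intertwines φ u x z) (h' : Intertwines φ u x' z') :
    Intertwines φ u (x * x') (z * z') := by
  intro i
  have h1 := h' i
  have h2 := h (x'.right i)
  refine ⟨by simp [h1.1, h2.1], ?_⟩
  rw [gain_mul, mul_assoc, h1.2, h1.1, ← mul_assoc, h2.2, gain_mul, mul_assoc]
  rfl

theorem pow (h : Intertwines φ u x z) (k : ℕ) : Intertwines φ u (x ^ k) (z ^ k) := by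
  induction k with
  | zero => simpa using one
  | succ k ih => rw [pow_succ, pow_succ]; exact ih.mul h

theorem right_pow (h : Intertwines φ u x z) (k : ℕ) (i : Fin m) :
    (z.right ^ k) (φ i) = φ ((x.right ^ k) i) := by
  simpa using (h.pow k i).1

theorem iterate (h : Intertwines φ u x z) (k : ℕ) (i : Fin m) :
    z.right^[k] (φ i) = φ (x.right^[k] i) := by
  simpa [Equiv.Perm.coe_pow] using h.right_pow k i

theorem sameCycle (h : Intertwines φ u x z) (hφ : φ.Injective) (i j : Fin m) :
    z.right.SameCycle (φ i) (φ j) ↔ x.right.SameCycle i j := by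
  constructor
  · intro hs
    obtain ⟨k, hk⟩ := hs.exists_nat_pow_eq
    exact ⟨k, hφ (by simpa [← h.right_pow] using hk)⟩
  · intro hs
    obtain ⟨k, rfl⟩ := hs.exists_nat_pow_eq
    exact ⟨k, by simp [← h.right_pow]⟩

theorem exists_of_sameCycle (h : Intertwines φ u x z) {i : Fin m} {j : Fin n}
    (hs : z.right.SameCycle (φ i) j) : ∃ k, φ k = j := by
  obtain ⟨k, rfl⟩ := hs.exists_nat_pow_eq
  exact ⟨_, (h.right_pow k i).symm⟩

theorem cycleLength_eq (h : Intertwines φ u x z) (hφ : φ.Injective) (i : Fin m) :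
    z.cycleLength (φ i) = x.cycleLength i := by
  rw [cycleLength, cycleLength, Function.minimalPeriod_eq_minimalPeriod_iff]
  intro k
  rw [Function.IsPeriodicPt, Function.IsPeriodicPt, Function.IsFixedPt, Function.IsFixedPt,
    h.iterate, hφ.eq_iff]

end Intertwines

theorem right_pow_cycleLength (x : Wreath Γ n) (i : Fin n) :
    (x.right ^ x.cycleLength i) i = i := by
  rw [Equiv.Perm.coe_pow]
  exact Function.iterate_minimalPeriod

theorem cycleLength_pos (x : Wreath Γ n) (i : Fin n) : 0 < x.cycleLength i := by
  refine Function.minimalPeriod_pos_of_mem_periodicPts ?_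
  exact Function.Injective.mem_periodicPts x.right.injective i

theorem cycleLength_eq_one {x : Wreath Γ n} {i : Fin n} : x.cycleLength i = 1 ↔ x.right i = i :=
  Function.minimalPeriod_eq_one_iff_isFixedPt

theorem cycleClass_eq (x : Wreath Γ n) (i : Fin n) :
    x.cycleClass i = ConjClasses.mk (gain (x ^ x.cycleLength i) i) := by
  rw [cycleClass, gain, right_pow, right_pow_cycleLength]

theorem Intertwines.cycleClass_eq {φ : Fin m → Fin n} {u : Fin m → Γ} {x : Wreath Γ m}
    {z : Wreath Γ n} (h : Intertwines φ u x z) (hφ : φ.Injective) (i : Fin m) :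
    z.cycleClass (φ i) = x.cycleClass i := by
  rw [Wreath.cycleClass_eq, Wreath.cycleClass_eq, h.cycleLength_eq hφ, ConjClasses.mk_eq_mk_iff_isConj]
  have := (h.pow (x.cycleLength i) i).2
  rw [Wreath.right_pow, right_pow_cycleLength] at this
  rw [isConj_comm, isConj_iff]
  exact ⟨u i, by rw [← this, mul_inv_cancel_right]⟩

/-- Conjugation is one source of intertwiners. Powers of `x`, which commute with `x`, are another
and move along a cycle; embeddings into more points are a third. Invariance of length and class is
thus proved once for all three. -/
theorem intertwines_of_mul_eq {t x z : Wreath Γ n} (h : z * t = t * x) :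
    Intertwines t.right (gain t) x z := by
  refine fun i => ⟨?_, ?_⟩
  · simpa using congrArg (fun y => y.right i) h
  · simpa using congrArg (fun y => gain y i) h

theorem intertwines_zpow (x : Wreath Γ n) (k : ℤ) :
    Intertwines (x.right ^ k : Equiv.Perm (Fin n)) (gain (x ^ k)) x x := by
  rw [← right_zpow]
  exact intertwines_of_mul_eq (Commute.self_zpow x k).eq

theorem cycleLength_eq_of_sameCycle {x : Wreath Γ n} {i j : Fin n} (h : x.right.SameCycle i j) :
    x.cycleLength j = x.cycleLength i := by
  obtain ⟨k, rfl⟩ := h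
  exact (intertwines_zpow x k).cycleLength_eq (Equiv.injective _) i

theorem cycleClass_eq_of_sameCycle {x : Wreath Γ n} {i j : Fin n} (h : x.right.SameCycle i j) :
    x.cycleClass j = x.cycleClass i := by
  obtain ⟨k, rfl⟩ := h
  exact (intertwines_zpow x k).cycleClass_eq (Equiv.injective _) i

/-! ### Modified types as sums over cycles -/

open Classical in
/-- The contribution to the modified type of the cycle through `i`. -/
def cycleType (x : Wreath Γ n) (i : Fin n) : PartFn Γ :=
  ⟨fun c => if x.cycleClass i = c then
    Partn.ofNat (if c = ConjClasses.mk 1 then x.cycleLength i - 1 else x.cycleLength i) else 0⟩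

theorem cycleType_eq_of_sameCycle {x : Wreath Γ n} {i j : Fin n} (h : x.right.SameCycle i j) :
    x.cycleType j = x.cycleType i := by
  rw [cycleType, cycleType, cycleLength_eq_of_sameCycle h, cycleClass_eq_of_sameCycle h]

theorem Intertwines.cycleType_eq {φ : Fin m → Fin n} {u : Fin m → Γ} {x : Wreath Γ m}
    {z : Wreath Γ n} (h : Intertwines φ u x z) (hφ : φ.Injective) (i : Fin m) :
    z.cycleType (φ i) = x.cycleType i := by
  rw [cycleType, cycleType, h.cycleLength_eq hφ, h.cycleClass_eq hφ]

open Classical in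
/-- The least elements of the cycles. -/
def reps (x : Wreath Γ n) : Finset (Fin n) :=
  Finset.univ.filter fun i => ∀ j, x.right.SameCycle i j → i ≤ j

theorem mem_reps {x : Wreath Γ n} {i : Fin n} :
    i ∈ x.reps ↔ ∀ j, x.right.SameCycle i j → i ≤ j := by
  simp [reps]

theorem exists_rep (x : Wreath Γ n) (i : Fin n) : ∃ r ∈ x.reps, x.right.SameCycle i r := by
  classical
  obtain ⟨r, hr, hmin⟩ := Finset.exists_min_image (Finset.univ.filter fun j => x.right.SameCycle i j)
    id ⟨i, by simp [Equiv.Perm.SameCycle.refl]⟩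
  simp only [Finset.mem_filter, Finset.mem_univ, true_and, id] at hr hmin
  exact ⟨r, mem_reps.2 fun j hj => hmin j (hr.trans hj), hr⟩

/-- The least element of the cycle through `i`. -/
def rep (x : Wreath Γ n) (i : Fin n) : Fin n := (exists_rep x i).choose

theorem rep_mem (x : Wreath Γ n) (i : Fin n) : x.rep i ∈ x.reps := (exists_rep x i).choose_spec.1

theorem sameCycle_rep (x : Wreath Γ n) (i : Fin n) : x.right.SameCycle i (x.rep i) :=
  (exists_rep x i).choose_spec.2

theorem eq_of_mem_reps {x : Wreath Γ n} {i j : Fin n} (hi : i ∈ x.reps) (hj : j ∈ x.reps)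
    (h : x.right.SameCycle i j) : i = j :=
  le_antisymm (mem_reps.1 hi j h) (mem_reps.1 hj i h.symm)

theorem rep_eq_iff {x : Wreath Γ n} {i r : Fin n} (hr : r ∈ x.reps) :
    x.rep i = r ↔ x.right.SameCycle i r :=
  ⟨fun h => h ▸ sameCycle_rep x i,
    fun h => eq_of_mem_reps (rep_mem x i) hr ((sameCycle_rep x i).symm.trans h)⟩

open Classical in
/-- The least elements of the cycles that lie in a given set. -/
def repsOn (x : Wreath Γ n) (A : Set (Fin n)) : Finset (Fin n) := x.reps.filter (· ∈ A)

theorem mem_repsOn {x : Wreath Γ n} {A : Set (Fin n)} {i : Fin n} :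
    i ∈ x.repsOn A ↔ i ∈ x.reps ∧ i ∈ A := by
  simp [repsOn]

/-- The part of the modified type that comes from the cycles in an invariant set. -/
def typeOn (x : Wreath Γ n) (A : Set (Fin n)) : PartFn Γ := ∑ i ∈ x.repsOn A, x.cycleType i

theorem _root_.Partn.filterMap_eq_sum (F : ℕ → Option ℕ+) (h0 : F 0 = none)
    (h1 : ∀ k, 0 < k → F k = some k.toPNat') (M : Multiset ℕ) :
    M.filterMap F = (M.map Partn.ofNat).sum := by
  induction M using Multiset.induction_on with
  | empty => rfl
  | cons k M ih =>
    rw [Multiset.map_cons, Multiset.sum_cons, ← ih]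
    rcases Nat.eq_zero_or_pos k with rfl | h
    · rw [Multiset.filterMap_cons_none 0 M h0, Partn.ofNat_zero, zero_add]
    · rw [Multiset.filterMap_cons_some _ k M (h1 k h), Partn.ofNat, if_pos h,
        Multiset.singleton_add]

open Classical in
theorem modifiedType_eq_sum (x : Wreath Γ n) : x.modifiedType = ∑ i ∈ x.reps, x.cycleType i := by
  ext c : 2
  rw [PartFn.sum_part]
  have h : x.modifiedType.part c = (((x.cycleLengths c).map
      fun k => if c = ConjClasses.mk 1 then k - 1 else k).map Partn.ofNat).sum := by
    unfold modifiedType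
    dsimp only
    rw [Partn.filterMap_eq_sum]
    · rfl
    · intro k hk
      rw [dif_pos hk]
      exact congrArg some (PNat.eq (by simp [hk]))
  simp only [h, cycleType]
  rw [← Finset.sum_filter, Multiset.map_map, cycleLengths, Multiset.map_map, reps,
    Finset.filter_filter]
  rfl

@[simp] theorem typeOn_univ (x : Wreath Γ n) : x.typeOn Set.univ = x.modifiedType := by
  rw [typeOn, modifiedType_eq_sum]
  congr 1
  ext i
  simp [mem_repsOn]

theorem typeOn_add_typeOn_compl (x : Wreath Γ n) (A : Set (Fin n)) :
    x.typeOn A + x.typeOn Aᶜ = x.modifiedType := by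
  classical
  rw [modifiedType_eq_sum, typeOn, typeOn,
    ← Finset.sum_filter_add_sum_filter_not x.reps (· ∈ A)]
  congr 2; ext i; simp [mem_repsOn]

/-- An injective intertwiner matches cycles with cycles but need not preserve least elements, so the
bijection of representatives sends `r` to `z.rep (φ r)`. -/
theorem Intertwines.typeOn_range {φ : Fin m → Fin n} {u : Fin m → Γ} {x : Wreath Γ m}
    {z : Wreath Γ n} (h : Intertwines φ u x z) (hφ : φ.Injective) :
    z.typeOn (Set.range φ) = x.modifiedType := by
  classical
  rw [typeOn, modifiedType_eq_sum]
  symm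
  refine Finset.sum_bij (fun r _ => z.rep (φ r)) (fun r hr => ?_) (fun r hr r' hr' he => ?_)
    (fun b hb => ?_) fun r hr => ?_
  · exact mem_repsOn.2 ⟨rep_mem _ _, h.exists_of_sameCycle (sameCycle_rep _ _)⟩
  · refine eq_of_mem_reps hr hr' ((h.sameCycle hφ r r').1 ?_)
    exact (sameCycle_rep z _).trans (he ▸ (sameCycle_rep z _).symm)
  · obtain ⟨hb, i, rfl⟩ := mem_repsOn.1 hb
    exact ⟨x.rep i, rep_mem _ _,
      (rep_eq_iff hb).2 ((h.sameCycle hφ _ _).2 (sameCycle_rep x i).symm)⟩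
  · rw [cycleType_eq_of_sameCycle (sameCycle_rep z _), h.cycleType_eq hφ]

theorem modifiedType_eq_of_mul_eq {t x z : Wreath Γ n} (h : z * t = t * x) :
    z.modifiedType = x.modifiedType := by
  rw [← (intertwines_of_mul_eq h).typeOn_range t.right.injective, t.right.surjective.range_eq,
    typeOn_univ]

/-- A union of cycles of `x`. -/
def Invariant (x : Wreath Γ n) (A : Set (Fin n)) : Prop := ∀ i, x.right i ∈ A ↔ i ∈ A

theorem Invariant.mem_iff {x : Wreath Γ n} {A : Set (Fin n)} (h : x.Invariant A) {i j : Fin n}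
    (hij : x.right.SameCycle i j) : i ∈ A ↔ j ∈ A := by
  obtain ⟨k, rfl⟩ := hij.exists_nat_pow_eq
  induction k with
  | zero => simp
  | succ k ih => rw [pow_succ', Equiv.Perm.mul_apply, h]; exact ih ⟨k, by simp⟩

/-- `x` fixes `i` with trivial coefficient. -/
def Fixes (x : Wreath Γ n) (i : Fin n) : Prop := x.right i = i ∧ gain x i = 1

theorem cycleLength_eq_one_and_cycleClass {x : Wreath Γ n} {i : Fin n} :
    x.cycleLength i = 1 ∧ x.cycleClass i = ConjClasses.mk 1 ↔ x.Fixes i := by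
  rw [Fixes, ← cycleLength_eq_one]
  refine and_congr_right fun h => ?_
  rw [cycleClass_eq, h, pow_one, ConjClasses.mk_eq_mk_iff_isConj, isConj_one_left]

theorem cycleType_eq_zero {x : Wreath Γ n} {i : Fin n} : x.cycleType i = 0 ↔ x.Fixes i := by
  rw [← cycleLength_eq_one_and_cycleClass]
  have h0 := cycleLength_pos x i
  constructor
  · intro h
    have := congrArg (fun ρ => (ρ.part (x.cycleClass i)).size) h
    simp only [cycleType, if_true, Partn.size_ofNat, PartFn.zero_part, Partn.size_zero] at this
    split_ifs at this with hc
    · exact ⟨by omega, hc⟩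
    · omega
  · rintro ⟨h1, h2⟩
    ext c : 2
    simp only [cycleType, h1, h2]
    split_ifs with h h' <;> simp_all

theorem degree_cycleType (x : Wreath Γ n) (i : Fin n) :
    (x.cycleType i).degree =
      open Classical in if x.cycleClass i = ConjClasses.mk 1 then x.cycleLength i - 1
        else x.cycleLength i := by
  rw [PartFn.degree, finsum_eq_single _ (x.cycleClass i)]
  · simp [cycleType]
  · intro c hc
    simp [cycleType, Ne.symm hc]

theorem card_filter_sameCycle (x : Wreath Γ n) (i : Fin n) :
    open Classical in (Finset.univ.filter fun j => x.right.SameCycle i j).card = x.cycleLength i := by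
  classical
  have := MulAction.minimalPeriod_eq_card (a := x.right) (b := i)
  rw [cycleLength]
  refine Eq.trans ?_ this.symm
  rw [← Set.toFinset_card]
  congr 1
  ext j
  simp only [Finset.mem_filter, Finset.mem_univ, true_and, Set.mem_toFinset, MulAction.mem_orbit_iff,
    Subgroup.exists_zpowers]
  rfl

/-- The representatives of the cycles with trivial cycle-product. -/
def balancedReps (x : Wreath Γ n) : Finset (Fin n) :=
  open Classical in x.reps.filter fun i => x.cycleClass i = ConjClasses.mk 1

theorem mem_balancedReps {x : Wreath Γ n} {i : Fin n} :
    i ∈ x.balancedReps ↔ i ∈ x.reps ∧ x.cycleClass i = ConjClasses.mk 1 := by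
  simp [balancedReps]

variable [Finite Γ]

-- A cycle of length `k` covers `k` points and contributes `k` to the degree, or `k - 1` if it is
-- balanced; summing over the cycles in `A` gives the identity.
open Classical in
theorem degree_typeOn_add_card (x : Wreath Γ n) {A : Set (Fin n)} (hA : x.Invariant A) :
    (x.typeOn A).degree + (x.balancedReps.filter (· ∈ A)).card =
      (Finset.univ.filter (· ∈ A)).card := by
  have h1 : (x.balancedReps.filter (· ∈ A)).card =
      ∑ i ∈ x.repsOn A, if x.cycleClass i = ConjClasses.mk 1 then 1 else 0 := by
    rw [← Finset.card_filter]
    congr 1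
    ext i
    simp only [Finset.mem_filter, mem_balancedReps, mem_repsOn]
    tauto
  rw [h1, Finset.card_eq_sum_card_fiberwise (f := x.rep) (t := x.repsOn A), typeOn,
    PartFn.degree_sum, ← Finset.sum_add_distrib]
  · refine Finset.sum_congr rfl fun i hi => ?_
    obtain ⟨hi, hiA⟩ := mem_repsOn.1 hi
    rw [degree_cycleType, Finset.filter_filter]
    have : (Finset.univ.filter fun a => a ∈ A ∧ x.rep a = i) =
        Finset.univ.filter fun j => x.right.SameCycle i j := by
      ext j
      simp only [Finset.mem_filter, Finset.mem_univ, true_and, rep_eq_iff hi]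
      exact ⟨fun h => h.2.symm, fun h => ⟨(hA.mem_iff h).1 hiA, h.symm⟩⟩
    rw [this, card_filter_sameCycle]
    have := cycleLength_pos x i
    split_ifs <;> omega
  · intro i hi
    have hi : i ∈ A := by simpa using hi
    exact mem_repsOn.2 ⟨rep_mem _ _, (hA.mem_iff (sameCycle_rep x i)).1 hi⟩

theorem degree_modifiedType_add_card (x : Wreath Γ n) :
    x.modifiedType.degree + x.balancedReps.card = n := by
  have := degree_typeOn_add_card x (A := Set.univ) fun i => by simp
  simpa using this

end Wreath

/-! ### Flats of gain graphs -/

namespace GainGraph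

variable {ι Γ : Type*} [Group Γ]

/-- The functions `f` with `f j = g * f i` for every edge `(i, j, g)`. -/
def flat (S : Set (ι × ι × Γ)) : Set (ι → WithZero Γ) :=
  {f | ∀ e ∈ S, f e.2.1 = e.2.2 * f e.1}

/-- Two vertices are connected by edges. -/
def Conn (S : Set (ι × ι × Γ)) : ι → ι → Prop := Relation.EqvGen fun a b => ∃ g, (a, b, g) ∈ S

theorem flat_union (S T : Set (ι × ι × Γ)) : flat (S ∪ T) = flat S ∩ flat T := by
  ext f
  exact ⟨fun h => ⟨fun e he => h e (Or.inl he), fun e he => h e (Or.inr he)⟩,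
    fun h e he => he.elim (h.1 e) (h.2 e)⟩

theorem zero_mem_flat (S : Set (ι × ι × Γ)) : 0 ∈ flat S := fun e _ => by simp

theorem eq_iff_of_conn {S : Set (ι × ι × Γ)} {f f' : ι → WithZero Γ} (hf : f ∈ flat S)
    (hf' : f' ∈ flat S) {a b : ι} (h : Conn S a b) : f a = f' a ↔ f b = f' b := by
  induction h with
  | rel a b h =>
    obtain ⟨g, hg⟩ := h
    have h1 := hf _ hg
    have h2 := hf' _ hg
    simp only at h1 h2
    rw [h1, h2, mul_right_inj' WithZero.coe_ne_zero]
  | refl => rfl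
  | symm _ _ _ ih => exact ih.symm
  | trans _ _ _ _ _ h1 h2 => exact h1.trans h2

open Classical in
theorem piecewise_mem_flat {S : Set (ι × ι × Γ)} {f f' : ι → WithZero Γ} (hf : f ∈ flat S)
    (hf' : f' ∈ flat S) (a : ι) (t : WithZero Γ) :
    (fun b => if Conn S a b then f' b * t else f b) ∈ flat S := by
  intro e he
  have h : Conn S a e.1 ↔ Conn S a e.2.1 :=
    ⟨fun h => h.trans _ _ _ (.rel _ _ ⟨e.2.2, he⟩),
      fun h => h.trans _ _ _ (.symm _ _ (.rel _ _ ⟨e.2.2, he⟩))⟩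
  by_cases h1 : Conn S a e.1
  · simp only [h.1 h1, h1, if_true, hf' e he, mul_assoc]
  · simp only [← h, h1, if_false, hf e he]

variable [Finite ι] [Finite Γ]

instance : Finite (WithZero Γ) := inferInstanceAs (Finite (Option Γ))

/-- One equation costs at most a factor `|Γ| + 1`. Each solution is repaired by changing it only on
one connected component, that of `a`; the repaired function together with the lost value at `a`
recovers the solution, since a value at `a` determines a solution on its whole component. -/
theorem card_flat_le_insert (S : Set (ι × ι × Γ)) (e : ι × ι × Γ) :
    Nat.card (flat S) ≤ Nat.card (WithZero Γ) * Nat.card (flat (insert e S)) := by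
  classical
  obtain ⟨i, j, g⟩ := e
  rw [← Nat.card_prod]
  suffices h : ∃ T : (ι → WithZero Γ) → (ι → WithZero Γ), ∃ a, (∀ f ∈ flat S,
      T f ∈ flat S ∧ T f j = g * T f i ∧ ∀ b, ¬ Conn S a b → T f b = f b) by
    obtain ⟨T, a, hT⟩ := h
    refine Nat.card_le_card_of_injective
      (fun f => (f.1 a, ⟨T f.1, ?_⟩) : flat S → WithZero Γ × flat (insert (i, j, g) S)) ?_
    · intro e he
      rcases he with rfl | he
      · exact (hT _ f.2).2.1
      · exact (hT _ f.2).1 e he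
    · intro f f' h
      have h2 : T f.1 = T f'.1 := congrArg (fun p => p.2.1) h
      simp only [Prod.mk.injEq] at h
      ext1
      funext b
      by_cases hb : Conn S a b
      · exact (eq_iff_of_conn f.2 f'.2 hb).1 h.1
      · rw [← (hT _ f.2).2.2 b hb, ← (hT _ f'.2).2.2 b hb, h2]
  by_cases hA : Conn S i j ∨ ∀ f ∈ flat S, f j = 0
  -- Erasing `f` on the component of `i` satisfies the new edge: at `j` the result vanishes too, by
  -- connectedness or by hypothesis. The product `0 * 0` only matches the shape in
  -- `piecewise_mem_flat`.
  · refine ⟨fun f b => if Conn S i b then 0 * 0 else f b, i, fun f hf =>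
      ⟨piecewise_mem_flat hf (zero_mem_flat S) i 0, ?_, fun b hb => if_neg hb⟩⟩
    have hi : Conn S i i := .refl _
    simp only [hi, if_true, mul_zero, ite_eq_left_iff]
    exact fun h => (hA.resolve_left h) f hf
  · push Not at hA
    obtain ⟨hij, f₀, hf₀, h0⟩ := hA
    -- The solution `f₀` is nonzero at `j`; its right multiple with the value `g * f i` at `j`
    -- replaces `f` on the component of `j`, which does not contain `i`.
    refine ⟨fun f b => if Conn S j b then f₀ b * ((f₀ j)⁻¹ * (g * f i)) else f b, j, fun f hf =>
      ⟨piecewise_mem_flat hf hf₀ j _, ?_, fun b hb => if_neg hb⟩⟩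
    have hj : Conn S j j := .refl _
    have hji : ¬ Conn S j i := fun h => hij (.symm _ _ h)
    simp only [hj, hji, if_true, if_false]
    rw [mul_inv_cancel_left₀ h0]

end GainGraph

/-! ### Fixed functions and subadditivity of the degree -/

namespace Wreath

open GainGraph

variable {Γ : Type*} [Group Γ] {n : ℕ}

/-- The functions on `Fin n`, with values in `Γ` with a zero adjoined, that are fixed by `x`. -/
def fixSet (x : Wreath Γ n) : Set (Fin n → WithZero Γ) :=
  {f | ∀ i, f (x.right i) = gain x i * f i}

theorem fixSet_inter_subset (x y : Wreath Γ n) : x.fixSet ∩ y.fixSet ⊆ (x * y).fixSet := by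
  intro f hf i
  rw [SemidirectProduct.mul_right, Equiv.Perm.mul_apply, hf.1, hf.2, gain_mul, WithZero.coe_mul,
    mul_assoc]

theorem fixSet_pow {x : Wreath Γ n} {f : Fin n → WithZero Γ} (hf : f ∈ x.fixSet) (k : ℕ) :
    f ∈ (x ^ k).fixSet := by
  induction k with
  | zero => intro i; simp
  | succ k ih => rw [pow_succ]; exact fixSet_inter_subset _ _ ⟨ih, hf⟩

theorem cycleClass_eq_one_of_fixSet {x : Wreath Γ n} {f : Fin n → WithZero Γ} (hf : f ∈ x.fixSet)
    {i : Fin n} (hi : f i ≠ 0) : x.cycleClass i = ConjClasses.mk 1 := by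
  have := fixSet_pow hf (x.cycleLength i) i
  rw [right_pow, right_pow_cycleLength] at this
  have h1 : ((gain (x ^ x.cycleLength i) i : Γ) : WithZero Γ) = 1 := by
    refine mul_right_cancel₀ hi ?_
    rw [← this, one_mul]
  rw [cycleClass_eq, WithZero.coe_inj.1 (h1.trans WithZero.coe_one.symm)]

theorem fixSet_eq_iff_of_sameCycle {x : Wreath Γ n} {f f' : Fin n → WithZero Γ} (hf : f ∈ x.fixSet)
    (hf' : f' ∈ x.fixSet) {i j : Fin n} (h : x.right.SameCycle i j) : f i = f' i ↔ f j = f' j := by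
  obtain ⟨k, rfl⟩ := h.exists_nat_pow_eq
  have h1 := fixSet_pow hf k i
  have h2 := fixSet_pow hf' k i
  rw [right_pow] at h1 h2
  rw [h1, h2, mul_right_inj' WithZero.coe_ne_zero]

open Classical in
theorem single_mem_fixSet_iff {x : Wreath Γ n} {i : Fin n} :
    Pi.single i 1 ∈ x.fixSet ↔ x.Fixes i := by
  constructor
  · intro h
    have h1 := h i
    have h2 : x.right i = i := by
      by_contra h2
      simp [h2] at h1
    refine ⟨h2, ?_⟩
    rw [h2] at h1
    simp only [Pi.single_eq_same, mul_one] at h1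
    exact WithZero.coe_inj.1 (h1.symm.trans WithZero.coe_one.symm)
  · rintro ⟨h1, h2⟩ j
    by_cases hj : j = i
    · subst hj
      simp [h1, h2]
    · have : x.right j ≠ i := fun h => hj (x.right.injective (h.trans h1.symm))
      simp [hj, this]

theorem zero_mem_fixSet (x : Wreath Γ n) : 0 ∈ x.fixSet := fun i => by simp

theorem injective_restrict_balancedReps (x : Wreath Γ n) :
    Function.Injective fun (f : x.fixSet) (i : x.balancedReps) => f.1 i.1 := by
  intro f f' h
  ext1
  funext i
  by_cases hc : x.cycleClass i = ConjClasses.mk 1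
  · refine (fixSet_eq_iff_of_sameCycle f.2 f'.2 (sameCycle_rep x i)).2 ?_
    refine congrFun h ⟨x.rep i, mem_balancedReps.2 ⟨rep_mem x i, ?_⟩⟩
    rw [cycleClass_eq_of_sameCycle (sameCycle_rep x i), hc]
  · rw [not_imp_comm.1 (cycleClass_eq_one_of_fixSet f.2) hc,
      not_imp_comm.1 (cycleClass_eq_one_of_fixSet f'.2) hc]

theorem card_balancedReps_fun (x : Wreath Γ n) :
    Nat.card (x.balancedReps → WithZero Γ) = Nat.card (WithZero Γ) ^ x.balancedReps.card := by
  rw [Nat.card_fun, Nat.card_eq_fintype_card (α := x.balancedReps), Fintype.card_coe]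

/-- The edges of `x` that start in a given set. -/
def edges (x : Wreath Γ n) (T : Finset (Fin n)) : Set (Fin n × Fin n × Γ) :=
  {e | ∃ i ∈ T, e = (i, x.right i, gain x i)}

theorem mem_flat_edges {x : Wreath Γ n} {T : Finset (Fin n)} {f : Fin n → WithZero Γ} :
    f ∈ flat (x.edges T) ↔ ∀ i ∈ T, f (x.right i) = gain x i * f i := by
  refine ⟨fun h i hi => h _ ⟨i, hi, rfl⟩, ?_⟩
  rintro h _ ⟨i, hi, rfl⟩
  exact h i hi

/-- The edge leaving the representative of a balanced cycle is redundant: going around the cycle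
along the other edges gives its equation, because the cycle-product is trivial. Hence `x` imposes
only as many equations as its degree. -/
theorem flat_edges_compl_balancedReps (x : Wreath Γ n) :
    flat (x.edges x.balancedRepsᶜ) = x.fixSet := by
  ext f
  rw [mem_flat_edges]
  refine ⟨fun h i => ?_, fun h i _ => h i⟩
  by_cases hi : i ∈ x.balancedReps
  · obtain ⟨hi, hc⟩ := mem_balancedReps.1 hi
    have key : ∀ j, j < x.cycleLength i →
        f ((x.right ^ j) (x.right i)) = gain (x ^ j) (x.right i) * f (x.right i) := by
      intro j
      induction j with
      | zero => intro; simp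
      | succ j ih =>
        intro hj
        have h1 : (x.right ^ j) (x.right i) ∉ x.balancedReps := by
          intro h2
          have h3 := eq_of_mem_reps hi (mem_balancedReps.1 h2).1 ⟨j + 1, by
            rw [← Equiv.Perm.mul_apply, ← pow_succ]; norm_cast⟩
          rw [← Equiv.Perm.mul_apply, ← pow_succ, Equiv.Perm.coe_pow] at h3
          exact Function.not_isPeriodicPt_of_pos_of_lt_minimalPeriod (by omega) hj h3.symm
        have h2 := h _ (Finset.mem_compl.2 h1)
        rw [pow_succ', Equiv.Perm.mul_apply, h2, ih (by omega), pow_succ', gain_mul, right_pow,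
          WithZero.coe_mul, mul_assoc]
    have h0 := cycleLength_pos x i
    have h1 := key (x.cycleLength i - 1) (by omega)
    rw [← Equiv.Perm.mul_apply, ← pow_succ, Nat.sub_add_cancel h0, right_pow_cycleLength] at h1
    have h2 : gain (x ^ (x.cycleLength i - 1)) (x.right i) * gain x i = 1 := by
      rw [← gain_mul, ← pow_succ, Nat.sub_add_cancel h0]
      rwa [cycleClass_eq, ConjClasses.mk_eq_mk_iff_isConj, isConj_one_left] at hc
    rw [h1, eq_inv_of_mul_eq_one_right h2, WithZero.coe_inv,
      inv_mul_cancel_left₀ WithZero.coe_ne_zero]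
  · exact h i (Finset.mem_compl.2 hi)

variable [Finite Γ]

theorem card_flat_le_inter_edges (S : Set (Fin n × Fin n × Γ)) (x : Wreath Γ n)
    (T : Finset (Fin n)) : Nat.card (flat S) ≤
      Nat.card (WithZero Γ) ^ T.card * Nat.card (flat (S ∪ x.edges T)) := by
  classical
  induction T using Finset.induction_on with
  | empty =>
    have : x.edges ∅ = ∅ := by ext e; simp [edges]
    simp [this]
  | insert i T hi ih =>
    have : S ∪ x.edges (insert i T) = insert (i, x.right i, gain x i) (S ∪ x.edges T) := by
      ext e
      simp only [edges, Set.mem_union, Set.mem_insert_iff, Finset.mem_insert]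
      constructor
      · rintro (h | ⟨j, rfl | hj, rfl⟩)
        · exact Or.inr (Or.inl h)
        · exact Or.inl rfl
        · exact Or.inr (Or.inr ⟨j, hj, rfl⟩)
      · rintro (rfl | h | ⟨j, hj, rfl⟩)
        · exact Or.inr ⟨i, Or.inl rfl, rfl⟩
        · exact Or.inl h
        · exact Or.inr ⟨j, Or.inr hj, rfl⟩
    rw [this, Finset.card_insert_of_notMem hi, pow_succ, mul_assoc]
    exact ih.trans (Nat.mul_le_mul_left _ (card_flat_le_insert _ _))

theorem card_compl_balancedReps (x : Wreath Γ n) :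
    x.balancedRepsᶜ.card = x.modifiedType.degree := by
  have := degree_modifiedType_add_card x
  rw [Finset.card_compl, Fintype.card_fin]
  omega

theorem le_card_fixSet_inter (x y : Wreath Γ n) : Nat.card (WithZero Γ) ^ n ≤
    Nat.card (WithZero Γ) ^ (x.modifiedType.degree + y.modifiedType.degree) *
      Nat.card ↥(x.fixSet ∩ y.fixSet) := by
  have h0 : Nat.card (flat (∅ : Set (Fin n × Fin n × Γ))) = Nat.card (WithZero Γ) ^ n := by
    have : flat (∅ : Set (Fin n × Fin n × Γ)) = Set.univ := by ext; simp [flat]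
    rw [this, Nat.card_congr (Equiv.Set.univ _), Nat.card_fun, Nat.card_fin]
  rw [← h0, ← flat_edges_compl_balancedReps x, ← flat_edges_compl_balancedReps y, ← flat_union,
    pow_add, mul_assoc, ← card_compl_balancedReps, ← card_compl_balancedReps]
  refine (card_flat_le_inter_edges ∅ x x.balancedRepsᶜ).trans (Nat.mul_le_mul_left _ ?_)
  rw [Set.empty_union]
  exact card_flat_le_inter_edges _ y _

theorem card_fixSet_le (x : Wreath Γ n) :
    Nat.card x.fixSet ≤ Nat.card (WithZero Γ) ^ x.balancedReps.card := by
  rw [← card_balancedReps_fun]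
  exact Nat.card_le_card_of_injective _ (injective_restrict_balancedReps x)

theorem one_lt_card_withZero : 1 < Nat.card (WithZero Γ) := Finite.one_lt_card

/-- Comparing exponents of `|Γ| + 1` in the lower bound for `Fix x ∩ Fix y` and the upper bound for
`Fix (x * y)` gives the inequality. -/
theorem degree_mul_le (x y : Wreath Γ n) :
    (x * y).modifiedType.degree ≤ x.modifiedType.degree + y.modifiedType.degree := by
  have h1 := le_card_fixSet_inter x y
  have h2 := (Nat.card_mono (Set.toFinite _) (fixSet_inter_subset x y)).trans (card_fixSet_le _)
  have h3 := h1.trans (Nat.mul_le_mul_left _ h2)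
  rw [← pow_add, Nat.pow_le_pow_iff_right one_lt_card_withZero] at h3
  have := degree_modifiedType_add_card (x * y)
  omega

/-- When the degrees add up, the two bounds coincide, so the inclusion of finite sets has no room to
be strict. -/
theorem fixSet_mul_eq {x y : Wreath Γ n}
    (h : (x * y).modifiedType.degree = x.modifiedType.degree + y.modifiedType.degree) :
    (x * y).fixSet = x.fixSet ∩ y.fixSet := by
  symm
  refine Set.eq_of_subset_of_ncard_le (fixSet_inter_subset x y) ?_ (Set.toFinite _)
  rw [← Nat.card_coe_set_eq, ← Nat.card_coe_set_eq]
  refine (card_fixSet_le _).trans ?_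
  have h1 := le_card_fixSet_inter x y
  have h2 : Nat.card (WithZero Γ) ^ n = _ :=
    congrArg (Nat.card (WithZero Γ) ^ ·) (degree_modifiedType_add_card (x * y)).symm
  rw [h2, ← h, pow_add] at h1
  exact Nat.le_of_mul_le_mul_left h1 (pow_pos (one_lt_card_withZero.trans' one_pos) _)

/-- The indicator function of the point `i` is a fixed function exactly when `i` is fixed with
trivial coefficient. -/
theorem fixes_of_fixes_mul {x y : Wreath Γ n}
    (h : (x * y).modifiedType.degree = x.modifiedType.degree + y.modifiedType.degree) {i : Fin n}
    (hi : (x * y).Fixes i) : x.Fixes i ∧ y.Fixes i := by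
  classical
  rw [← single_mem_fixSet_iff, fixSet_mul_eq h] at hi
  exact ⟨single_mem_fixSet_iff.1 hi.1, single_mem_fixSet_iff.1 hi.2⟩

end Wreath

theorem Partn.count_ofNat (k : ℕ) (r : ℕ+) :
    Multiset.count r (Partn.ofNat k) = if k = r then 1 else 0 := by
  rcases Nat.eq_zero_or_pos k with rfl | hk
  · simp [r.ne_zero.symm]
  · lift k to ℕ+ using hk
    simp [Partn.ofNat_coe, Multiset.count_singleton, eq_comm]

namespace Wreath

variable {Γ : Type*} [Group Γ] {m n k : ℕ}

/-! ### Direct sums -/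

/-- The element acting as `x` on the first `m` and as `y` on the last `k` points. -/
def dsum (x : Wreath Γ m) (y : Wreath Γ k) : Wreath Γ (m + k) :=
  ofGain (finSumFinEquiv.permCongr (Equiv.sumCongr x.right y.right))
    (Fin.addCases (gain x) (gain y))

@[simp] theorem right_dsum_castAdd (x : Wreath Γ m) (y : Wreath Γ k) (i : Fin m) :
    (dsum x y).right (Fin.castAdd k i) = Fin.castAdd k (x.right i) := by
  simp [dsum, Equiv.permCongr_apply]

@[simp] theorem right_dsum_natAdd (x : Wreath Γ m) (y : Wreath Γ k) (i : Fin k) :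
    (dsum x y).right (Fin.natAdd m i) = Fin.natAdd m (y.right i) := by
  simp [dsum, Equiv.permCongr_apply]

@[simp] theorem gain_dsum_castAdd (x : Wreath Γ m) (y : Wreath Γ k) (i : Fin m) :
    gain (dsum x y) (Fin.castAdd k i) = gain x i := by
  simp [dsum]

@[simp] theorem gain_dsum_natAdd (x : Wreath Γ m) (y : Wreath Γ k) (i : Fin k) :
    gain (dsum x y) (Fin.natAdd m i) = gain y i := by
  simp [dsum]

theorem intertwines_castAdd (x : Wreath Γ m) (y : Wreath Γ k) :
    Intertwines (Fin.castAdd k) (fun _ => 1) x (dsum x y) := fun i => by simp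

theorem intertwines_natAdd (x : Wreath Γ m) (y : Wreath Γ k) :
    Intertwines (Fin.natAdd m) (fun _ => 1) y (dsum x y) := fun i => by simp

theorem dsum_mul_dsum (x x' : Wreath Γ m) (y y' : Wreath Γ k) :
    dsum x y * dsum x' y' = dsum (x * x') (y * y') := by
  refine ext_gain (Fin.addCases ?_ ?_) (Fin.addCases ?_ ?_) <;> intro i <;> simp

theorem modifiedType_dsum (x : Wreath Γ m) (y : Wreath Γ k) :
    (dsum x y).modifiedType = x.modifiedType + y.modifiedType := by
  have h : (Set.range (Fin.castAdd k : Fin m → Fin (m + k)))ᶜ = Set.range (Fin.natAdd m) := by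
    ext i
    refine Fin.addCases (fun i => ?_) (fun i => ?_) i
    · simp [Fin.ext_iff]
      intro j; omega
    · simp [Fin.ext_iff]
      intro j; omega
  rw [← typeOn_add_typeOn_compl _ (Set.range (Fin.castAdd k)), h,
    (intertwines_castAdd x y).typeOn_range (Fin.castAdd_injective _ _),
    (intertwines_natAdd x y).typeOn_range (Fin.natAdd_injective _ _)]

theorem modifiedType_eq_zero_iff {x : Wreath Γ n} : x.modifiedType = 0 ↔ x = 1 := by
  constructor
  · intro h
    have h0 : ∀ i ∈ x.reps, x.Fixes i := by
      intro i hi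
      rw [← cycleType_eq_zero]
      ext c : 2
      have := congrArg (fun ρ => ρ.part c) h
      simp only [modifiedType_eq_sum, PartFn.sum_part, PartFn.zero_part] at this
      exact (Finset.sum_eq_zero_iff (M := Partn)).1 this i hi
    have h1 : ∀ i, x.Fixes i := by
      intro i
      have := cycleType_eq_of_sameCycle (sameCycle_rep x i)
      rw [← cycleType_eq_zero, ← this, cycleType_eq_zero]
      exact h0 _ (rep_mem x i)
    exact ext_gain (fun i => (h1 i).1) fun i => (h1 i).2
  · rintro rfl
    rw [modifiedType_eq_sum]
    exact Finset.sum_eq_zero fun i _ => cycleType_eq_zero.2 ⟨rfl, rfl⟩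

theorem modifiedType_one : (1 : Wreath Γ n).modifiedType = 0 := modifiedType_eq_zero_iff.2 rfl

theorem modifiedType_dsum_one (x : Wreath Γ m) :
    (dsum x (1 : Wreath Γ k)).modifiedType = x.modifiedType := by
  rw [modifiedType_dsum, modifiedType_one, add_zero]

theorem dsum_one_injective : Function.Injective fun x : Wreath Γ m => dsum x (1 : Wreath Γ k) := by
  intro x y h
  refine ext_gain (fun i => ?_) fun i => ?_
  · have := congrArg (fun z => z.right (Fin.castAdd k i)) h
    simpa using this
  · have := congrArg (fun z => gain z (Fin.castAdd k i)) h
    simpa using this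

theorem exists_eq_dsum_one {z : Wreath Γ (m + k)} (h : ∀ j, z.Fixes (Fin.natAdd m j)) :
    ∃ x : Wreath Γ m, dsum x 1 = z := by
  have h1 : ∀ i : Fin m, ∃ j : Fin m, Fin.castAdd k j = z.right (Fin.castAdd k i) := by
    intro i
    generalize hb : z.right (Fin.castAdd k i) = b
    induction b using Fin.addCases with
    | left j => exact ⟨j, rfl⟩
    | right j =>
      have := z.right.injective (hb.trans (h j).1.symm)
      simp only [Fin.ext_iff, Fin.val_castAdd, Fin.val_natAdd] at this
      omega
  choose φ hφ using h1
  have hinj : φ.Injective := by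
    intro i j hij
    have := congrArg (Fin.castAdd k) hij
    rw [hφ, hφ] at this
    exact Fin.castAdd_injective _ _ (z.right.injective this)
  refine ⟨ofGain (Equiv.ofBijective φ (Finite.injective_iff_bijective.1 hinj))
    fun i => gain z (Fin.castAdd k i), ?_⟩
  refine ext_gain (Fin.addCases (fun i => ?_) fun i => ?_) (Fin.addCases (fun i => ?_) fun i => ?_)
  · simp [hφ]
  · simp [(h i).1]
  · simp
  · simp [(h i).2]

theorem fixes_dsum_one (x : Wreath Γ m) (j : Fin k) :
    (dsum x (1 : Wreath Γ k)).Fixes (Fin.natAdd m j) := by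
  simp [Fixes]

/-! ### Elements of a given modified type -/

open Classical in
/-- The length of the cycles with class `c` that contribute the part `r` to the modified type. -/
def cycleLengthOfPart (c : ConjClasses Γ) (r : ℕ+) : ℕ :=
  if c = ConjClasses.mk 1 then r + 1 else r

theorem cycleLengthOfPart_pos (c : ConjClasses Γ) (r : ℕ+) : 0 < cycleLengthOfPart c r := by
  have := r.pos
  unfold cycleLengthOfPart
  split_ifs <;> omega

theorem cycleType_eq_single {x : Wreath Γ n} {i : Fin n} {c : ConjClasses Γ} {r : ℕ+}
    (hc : x.cycleClass i = c) (hr : x.cycleLength i = cycleLengthOfPart c r) :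
    x.cycleType i = PartFn.single c r := by
  ext c' : 2
  by_cases h : c' = c
  · subst h
    simp only [cycleType, hc, hr, if_true, PartFn.single_part_self, cycleLengthOfPart]
    rw [← Partn.ofNat_coe]
    split_ifs <;> simp
  · simp [cycleType, hc, Ne.symm h, PartFn.single_part_of_ne h]

theorem count_cycleType (x : Wreath Γ n) (i : Fin n) (c : ConjClasses Γ) (r : ℕ+) :
    ((x.cycleType i).part c).count r =
      open Classical in if x.cycleClass i = c ∧ x.cycleLength i = cycleLengthOfPart c r then 1
        else 0 := by
  split_ifs with h
  · rw [cycleType_eq_single h.1 h.2]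
    simp
  · simp only [cycleType]
    by_cases hc : x.cycleClass i = c
    · have h0 := cycleLength_pos x i
      have h1 := r.pos
      simp only [hc, true_and, cycleLengthOfPart] at h
      rw [if_pos hc, Partn.count_ofNat, if_neg]
      split_ifs at h ⊢ <;> omega
    · rw [if_neg hc, Multiset.count_zero]

open Classical in
theorem count_modifiedType (x : Wreath Γ n) (c : ConjClasses Γ) (r : ℕ+) :
    (x.modifiedType.part c).count r = (x.reps.filter fun i => x.cycleClass i = c ∧
      x.cycleLength i = cycleLengthOfPart c r).card := by
  rw [modifiedType_eq_sum, PartFn.sum_part, Multiset.count_sum', Finset.card_filter]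
  exact Finset.sum_congr rfl fun i _ => count_cycleType x i c r

theorem card_cycleType (x : Wreath Γ n) (i : Fin n) :
    Multiset.card ((x.cycleType i).part (ConjClasses.mk 1)) =
      open Classical in if x.cycleClass i = ConjClasses.mk 1 ∧ x.cycleLength i ≠ 1 then 1
        else 0 := by
  have := cycleLength_pos x i
  by_cases h : x.cycleClass i = ConjClasses.mk 1
  · by_cases h1 : x.cycleLength i = 1
    · simp [cycleType, h, h1]
    · have : 1 < x.cycleLength i := by omega
      simp [cycleType, h, h1, Partn.ofNat, this]
  · simp [cycleType, h]

open Classical in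
theorem card_modifiedType (x : Wreath Γ n) :
    Multiset.card (x.modifiedType.part (ConjClasses.mk 1)) = (x.reps.filter fun i =>
      x.cycleClass i = ConjClasses.mk 1 ∧ x.cycleLength i ≠ 1).card := by
  rw [modifiedType_eq_sum, PartFn.sum_part, Multiset.card_sum, Finset.card_filter]
  exact Finset.sum_congr rfl fun i _ => card_cycleType x i

-- The modified type counts all cycles except those of length one with trivial product, and the
-- number of these is recovered from `n` and the degree. The only remaining length is `l = 0`, which
-- no cycle has.
open Classical in
theorem card_reps_eq [Finite Γ] {x z : Wreath Γ n} (h : x.modifiedType = z.modifiedType)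
    (c : ConjClasses Γ) (l : ℕ) :
    (x.reps.filter fun i => x.cycleClass i = c ∧ x.cycleLength i = l).card =
      (z.reps.filter fun i => z.cycleClass i = c ∧ z.cycleLength i = l).card := by
  by_cases hl : ∃ r, l = cycleLengthOfPart c r
  · obtain ⟨r, rfl⟩ := hl
    rw [← count_modifiedType, ← count_modifiedType, h]
  · by_cases hc : c = ConjClasses.mk 1 ∧ l = 1
    · obtain ⟨rfl, rfl⟩ := hc
      have key : ∀ y : Wreath Γ n, (y.reps.filter fun i => y.cycleClass i = ConjClasses.mk 1 ∧
          y.cycleLength i = 1).card + Multiset.card (y.modifiedType.part (ConjClasses.mk 1)) +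
            y.modifiedType.degree = n := by
        intro y
        have h1 := degree_modifiedType_add_card y
        have h2 := Finset.card_filter_add_card_filter_not (s := y.balancedReps)
          (fun i => y.cycleLength i = 1)
        simp only [balancedReps, Finset.filter_filter] at h1 h2
        rw [card_modifiedType]
        simp only [ne_eq]
        omega
      have h1 := key x
      have h2 := key z
      rw [← h] at h2
      omega
    · have h0 : ∀ y : Wreath Γ n,
          (y.reps.filter fun i => y.cycleClass i = c ∧ y.cycleLength i = l) = ∅ := by
        intro y
        rw [Finset.filter_eq_empty_iff]
        rintro i - ⟨h1, h2⟩
        have h3 := cycleLength_pos y i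
        by_cases h4 : c = ConjClasses.mk 1
        · refine hl ⟨⟨l - 1, ?_⟩, ?_⟩
          · have : l ≠ 1 := fun h => hc ⟨h4, h⟩
            omega
          · simp only [cycleLengthOfPart, h4, if_true, PNat.mk_coe]
            omega
        · exact hl ⟨⟨l, by omega⟩, by simp [cycleLengthOfPart, h4]⟩
      rw [h0, h0]

theorem exists_reps_equiv [Finite Γ] {x z : Wreath Γ n} (h : x.modifiedType = z.modifiedType) :
    ∃ e : x.reps ≃ z.reps, ∀ r : x.reps, z.cycleClass (e r) = x.cycleClass r ∧
      z.cycleLength (e r) = x.cycleLength r := by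
  classical
  have e : ∀ p : ConjClasses Γ × ℕ,
      Nonempty ({r : x.reps // (x.cycleClass r, x.cycleLength r) = p} ≃
        {r : z.reps // (z.cycleClass r, z.cycleLength r) = p}) := by
    rintro ⟨c, l⟩
    have key : ∀ y : Wreath Γ n,
        Fintype.card {r : y.reps // (y.cycleClass r, y.cycleLength r) = (c, l)} =
        (y.reps.filter fun i => y.cycleClass i = c ∧ y.cycleLength i = l).card := by
      intro y
      rw [Fintype.card_subtype, ← Finset.card_map (Function.Embedding.subtype _)]
      congr 1
      ext i
      simp [and_comm, and_assoc]
    rw [← Fintype.card_eq, key, key]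
    exact card_reps_eq h c l
  refine ⟨Equiv.ofFiberEquiv fun p => (e p).some, fun r => ?_⟩
  have := Equiv.ofFiberEquiv_map (fun p => (e p).some) r
  exact ⟨congrArg Prod.fst this, congrArg Prod.snd this⟩

theorem gain_pow_add_mul {x : Wreath Γ n} {r : Fin n} {l : ℕ} (hl : (x.right ^ l) r = r)
    (a b : ℕ) : gain (x ^ (a + l * b)) r = gain (x ^ a) r * gain (x ^ l) r ^ b := by
  have h : ∀ b, ((x.right ^ l) ^ b) r = r := by
    intro b
    induction b with
    | zero => rfl
    | succ b ih => rw [pow_succ', Equiv.Perm.mul_apply, ih, hl]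
  have h' : gain ((x ^ l) ^ b) r = gain (x ^ l) r ^ b := by
    induction b with
    | zero => simp
    | succ b ih => rw [pow_succ', gain_mul, ih, right_pow, right_pow, h, pow_succ']
  rw [pow_add, pow_mul, gain_mul, right_pow, right_pow, h, h']

theorem mod_cycleLength_eq {x : Wreath Γ n} {r : Fin n} {a b : ℕ}
    (h : (x.right ^ a) r = (x.right ^ b) r) : a % x.cycleLength r = b % x.cycleLength r := by
  have h0 := cycleLength_pos x r
  rw [Equiv.Perm.coe_pow, Equiv.Perm.coe_pow, ← Function.iterate_mod_minimalPeriod_eq,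
    ← Function.iterate_mod_minimalPeriod_eq (n := b)] at h
  exact (Function.iterate_eq_iterate_iff_of_lt_minimalPeriod (Nat.mod_lt _ h0)
    (Nat.mod_lt _ h0)).1 h

/-- Cycles of `x` are matched with cycles of `z` of equal length and class. After a choice of `c r`
conjugating one cycle-product to the other, the conjugator is transported along each cycle from its
representative. -/
theorem exists_conj_of_modifiedType_eq [Finite Γ] {x z : Wreath Γ n}
    (h : x.modifiedType = z.modifiedType) : ∃ t : Wreath Γ n, z * t = t * x := by
  obtain ⟨e, he⟩ := exists_reps_equiv h
  have hc : ∀ r : x.reps, ∃ c : Γ, c * gain (x ^ x.cycleLength r) r =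
      gain (z ^ x.cycleLength r) (e r) * c := by
    intro r
    have := (he r).1
    rw [cycleClass_eq, cycleClass_eq, ConjClasses.mk_eq_mk_iff_isConj, isConj_comm, isConj_iff,
      (he r).2] at this
    obtain ⟨c, hc⟩ := this
    exact ⟨c, by rw [← hc, inv_mul_cancel_right]⟩
  choose c hc using hc
  have hj : ∀ i, ∃ j : ℕ, (x.right ^ j) (x.rep i) = i := fun i =>
    (sameCycle_rep x i).symm.exists_nat_pow_eq
  choose j hj using hj
  let r : Fin n → x.reps := fun i => ⟨x.rep i, rep_mem x i⟩
  let Φ : x.reps → ℕ → Fin n := fun r a => (z.right ^ a) (e r)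
  let U : x.reps → ℕ → Γ := fun r a => gain (z ^ a) (e r) * c r * (gain (x ^ a) r)⁻¹
  -- One full turn multiplies by the two cycle-products, which `c r` intertwines, so `Φ` and `U`
  -- depend on the exponent only modulo the cycle length.
  have hmod : ∀ (r : x.reps) a, Φ r a = Φ r (a % x.cycleLength r) ∧
      U r a = U r (a % x.cycleLength r) := by
    intro r a
    have hz : (z.right ^ x.cycleLength r) (e r) = e r := by
      rw [← (he r).2]; exact right_pow_cycleLength z _
    constructor
    · change (z.right ^ a) (e r) = (z.right ^ _) (e r)
      rw [Equiv.Perm.coe_pow, Equiv.Perm.coe_pow, ← (he r).2]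
      exact (Function.iterate_mod_minimalPeriod_eq).symm
    · have h1 := gain_pow_add_mul hz (a % x.cycleLength r) (a / x.cycleLength r)
      have h2 := gain_pow_add_mul (right_pow_cycleLength x r) (a % x.cycleLength r)
        (a / x.cycleLength r)
      rw [Nat.mod_add_div] at h1 h2
      have h3 : c r * gain (x ^ x.cycleLength r) r ^ (a / x.cycleLength r) =
          gain (z ^ x.cycleLength r) (e r) ^ (a / x.cycleLength r) * c r :=
        SemiconjBy.pow_right (hc r) _
      simp only [U]
      rw [h1, h2, mul_inv_rev, mul_assoc _ _ (c r), ← h3]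
      group
  have hwd : ∀ (q : x.reps) a, Φ (r ((x.right ^ a) q)) (j ((x.right ^ a) q)) = Φ q a ∧
      U (r ((x.right ^ a) q)) (j ((x.right ^ a) q)) = U q a := by
    intro q a
    have h1 : r ((x.right ^ a) q) = q := Subtype.ext
      ((rep_eq_iff q.2).2 (Equiv.Perm.sameCycle_pow_left.2 (.refl _ _)))
    have h2 := hj ((x.right ^ a) q)
    have h3 : x.rep ((x.right ^ a) q) = q := congrArg Subtype.val h1
    rw [h3] at h2
    rw [h1, (hmod q _).1, (hmod q _).2, mod_cycleLength_eq h2, ← (hmod q _).1, ← (hmod q _).2]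
    exact ⟨rfl, rfl⟩
  have hsurj : Function.Surjective fun i => Φ (r i) (j i) := by
    intro b
    obtain ⟨a, ha⟩ := (sameCycle_rep z b).symm.exists_nat_pow_eq
    obtain ⟨q, hq⟩ := e.surjective ⟨z.rep b, rep_mem z b⟩
    refine ⟨(x.right ^ a) q, (hwd q a).1.trans ?_⟩
    simp only [Φ, hq, ha]
  refine ⟨ofGain (Equiv.ofBijective _ (Finite.surjective_iff_bijective.1 hsurj))
    fun i => U (r i) (j i), ?_⟩
  have hstep : ∀ i, x.right i = (x.right ^ (j i + 1)) (r i) := by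
    intro i
    rw [pow_succ', Equiv.Perm.mul_apply, hj]
  refine ext_gain (fun i => ?_) fun i => ?_
  · simp only [SemidirectProduct.mul_right, Equiv.Perm.mul_apply, right_ofGain,
      Equiv.ofBijective_apply]
    rw [hstep i, (hwd _ _).1]
    simp only [Φ, pow_succ', Equiv.Perm.mul_apply]
  · simp only [gain_mul, right_ofGain, gain_ofGain, Equiv.ofBijective_apply]
    rw [hstep i, (hwd _ _).2]
    have h1 : (x.right ^ j i) (r i) = i := hj i
    simp only [U, Φ, pow_succ', gain_mul, right_pow, h1]
    group

/-- The cycle of length `k + 1` with cycle-product `g`. -/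
def cycle (k : ℕ) (g : Γ) : Wreath Γ (k + 1) :=
  ofGain (finRotate (k + 1)) fun i => if i = 0 then g else 1

theorem cycle_pow_zero (k : ℕ) (g : Γ) (j : ℕ) (hj : j ≤ k) :
    ((cycle k g).right ^ j) 0 = ⟨j, by omega⟩ ∧ gain (cycle k g ^ (j + 1)) 0 = g := by
  induction j with
  | zero => simp [cycle]
  | succ j ih =>
    obtain ⟨h1, h2⟩ := ih (by omega)
    have h3 : ((cycle k g).right ^ (j + 1)) 0 = ⟨j + 1, by omega⟩ := by
      rw [pow_succ', Equiv.Perm.mul_apply, h1]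
      exact finRotate_of_lt (by omega)
    refine ⟨h3, ?_⟩
    rw [pow_succ', gain_mul, h2, right_pow, h3]
    have h4 : (⟨j + 1, by omega⟩ : Fin (k + 1)) ≠ 0 := by
      rw [Ne, Fin.ext_iff]
      exact Nat.succ_ne_zero j
    rw [cycle, gain_ofGain, if_neg h4, one_mul]

theorem modifiedType_cycle {k : ℕ} {g : Γ} {r : ℕ+}
    (h : k + 1 = cycleLengthOfPart (ConjClasses.mk g) r) :
    (cycle k g).modifiedType = PartFn.single (ConjClasses.mk g) r := by
  classical
  have hs : ∀ i, (cycle k g).right.SameCycle 0 i := fun i => ⟨i, by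
    have := (cycle_pow_zero k g i (by omega)).1
    rwa [zpow_natCast]⟩
  have hl : (cycle k g).cycleLength 0 = k + 1 := by
    rw [← card_filter_sameCycle, Finset.filter_true_of_mem fun i _ => hs i]
    simp
  have hr : (cycle k g).reps = {0} := by
    have h0 : 0 ∈ (cycle k g).reps := mem_reps.2 fun j _ => Fin.zero_le j
    ext i
    rw [Finset.mem_singleton]
    exact ⟨fun hi => eq_of_mem_reps hi h0 (hs i).symm, fun hi => hi ▸ h0⟩
  rw [modifiedType_eq_sum, hr, Finset.sum_singleton]
  refine cycleType_eq_single ?_ (hl.trans h)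
  rw [cycleClass_eq, hl, (cycle_pow_zero k g k le_rfl).2]

theorem exists_modifiedType_eq_single (c : ConjClasses Γ) (r : ℕ+) :
    ∃ z : Wreath Γ (cycleLengthOfPart c r), z.modifiedType = PartFn.single c r := by
  obtain ⟨g, rfl⟩ := ConjClasses.exists_rep c
  obtain ⟨k, hk⟩ := Nat.exists_eq_succ_of_ne_zero (cycleLengthOfPart_pos (ConjClasses.mk g) r).ne'
  have h : k + 1 = cycleLengthOfPart (ConjClasses.mk g) r := hk.symm
  exact h ▸ ⟨cycle k g, modifiedType_cycle h⟩

theorem exists_modifiedType_eq [Finite Γ] (lam : PartFn Γ) :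
    ∃ z : Wreath Γ (lam.degree + Multiset.card (lam.part (ConjClasses.mk 1))),
      z.modifiedType = lam := by
  obtain ⟨M, rfl⟩ := PartFn.ofParts_surjective lam
  induction M using Multiset.induction_on with
  | empty => exact ⟨1, by rw [modifiedType_one, map_zero]⟩
  | cons p M ih =>
    obtain ⟨x, hx⟩ := exists_modifiedType_eq_single p.1 p.2
    obtain ⟨y, hy⟩ := ih
    have h : (PartFn.ofParts Γ (p ::ₘ M)).degree + Multiset.card
        ((PartFn.ofParts Γ (p ::ₘ M)).part (ConjClasses.mk 1)) = cycleLengthOfPart p.1 p.2 +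
        ((PartFn.ofParts Γ M).degree +
          Multiset.card ((PartFn.ofParts Γ M).part (ConjClasses.mk 1))) := by
      rw [PartFn.ofParts_cons, PartFn.degree_add, PartFn.degree_single, PartFn.add_part,
        Multiset.card_add, cycleLengthOfPart]
      split_ifs with hc
      · rw [hc, PartFn.single_part_self, Multiset.card_singleton]
        omega
      · rw [PartFn.single_part_of_ne (Ne.symm hc), Multiset.card_zero]
        omega
    rw [h]
    exact ⟨dsum x y, by rw [modifiedType_dsum, hx, hy, PartFn.ofParts_cons]⟩

end Wreath

namespace Wreath

variable {Γ : Type*} [Group Γ] {m n k : ℕ}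

/-! ### Counting factorizations -/

/-- The number of factorizations `z = x * y` with `x` and `y` of given modified types. -/
def numFact (lam mu : PartFn Γ) (z : Wreath Γ n) : ℕ :=
  Nat.card {x : Wreath Γ n // x.modifiedType = lam ∧ (x⁻¹ * z).modifiedType = mu}

theorem inv_dsum_one_mul (x z : Wreath Γ m) :
    (dsum x (1 : Wreath Γ k))⁻¹ * dsum z 1 = dsum (x⁻¹ * z) 1 := by
  rw [inv_mul_eq_iff_eq_mul, dsum_mul_dsum]
  simp

theorem coeff_mul_eq_sum [Fintype (Wreath Γ n)] (f g : MonoidAlgebra ℤ (Wreath Γ n))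
    (z : Wreath Γ n) : (f * g).coeff z = ∑ x, f.coeff x * g.coeff (x⁻¹ * z) := by
  rw [MonoidAlgebra.coeff_mul_apply_left, Finsupp.sum_fintype _ _ (by simp)]

variable [Finite Γ]

theorem numFact_le_of_injective {lam mu lam' mu' : PartFn Γ} {z : Wreath Γ m} {z' : Wreath Γ n}
    (F : Wreath Γ m → Wreath Γ n) (hF : F.Injective)
    (h : ∀ x, x.modifiedType = lam → (x⁻¹ * z).modifiedType = mu →
      (F x).modifiedType = lam' ∧ ((F x)⁻¹ * z').modifiedType = mu') :
    numFact lam mu z ≤ numFact lam' mu' z' :=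
  Nat.card_le_card_of_injective (fun x => ⟨F x.1, h x.1 x.2.1 x.2.2⟩) fun _ _ he =>
    Subtype.ext (hF (congrArg Subtype.val he))

/-- The factorization `z = x * y` is exchanged for `z = (x * y * x⁻¹) * x`, whose first factor is a
conjugate of `y`. -/
theorem numFact_comm (lam mu : PartFn Γ) (z : Wreath Γ n) :
    numFact lam mu z = numFact mu lam z := by
  suffices h : ∀ lam mu : PartFn Γ, numFact lam mu z ≤ numFact mu lam z from
    le_antisymm (h _ _) (h _ _)
  intro lam mu
  refine numFact_le_of_injective (fun x => z * x⁻¹) (fun x y h => by simpa using h)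
    fun x h1 h2 => ⟨?_, by simpa using h1⟩
  rw [← h2]
  exact modifiedType_eq_of_mul_eq (t := x) (by group)

theorem numFact_eq_of_mul_eq (lam mu : PartFn Γ) {t z z' : Wreath Γ n} (h : z' * t = t * z) :
    numFact lam mu z = numFact lam mu z' := by
  suffices h : ∀ t z z' : Wreath Γ n, z' * t = t * z → numFact lam mu z ≤ numFact lam mu z' by
    refine le_antisymm (h _ _ _ ‹_›) (h t⁻¹ _ _ ?_)
    rw [eq_inv_mul_iff_mul_eq, ← mul_assoc, ← ‹z' * t = t * z›, mul_inv_cancel_right]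
  intro t z z' h
  obtain rfl : z' = t * z * t⁻¹ := eq_mul_inv_of_mul_eq h
  refine numFact_le_of_injective (fun x => t * x * t⁻¹) (fun x y h => by simpa using h)
    fun x h1 h2 => ⟨?_, ?_⟩
  · rw [← h1]
    exact modifiedType_eq_of_mul_eq (t := t) (by group)
  · rw [← h2]
    exact modifiedType_eq_of_mul_eq (t := t) (by group)

/-- In top degree the added points, fixed by the product, are fixed by both factors, so every
factorization of `z ⊕ 1` comes from one of `z`. -/
theorem numFact_dsum_one {lam mu : PartFn Γ} {z : Wreath Γ m}
    (h : z.modifiedType.degree = lam.degree + mu.degree) :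
    numFact lam mu (dsum z (1 : Wreath Γ k)) = numFact lam mu z := by
  refine (Nat.card_congr (Equiv.ofBijective (fun x => ⟨dsum x.1 1, ?h⟩) ⟨?_, ?_⟩)).symm
  case h =>
    rw [inv_dsum_one_mul, modifiedType_dsum_one, modifiedType_dsum_one]
    exact x.2
  · intro x y hxy
    exact Subtype.ext (dsum_one_injective (congrArg Subtype.val hxy))
  · rintro ⟨x', h1, h2⟩
    have hx : ∃ x, dsum x (1 : Wreath Γ k) = x' := by
      refine exists_eq_dsum_one fun j => ?_
      refine (fixes_of_fixes_mul (y := x'⁻¹ * dsum z 1) ?_ ?_).1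
      · rw [mul_inv_cancel_left, modifiedType_dsum_one, h1, h2, h]
      · rw [mul_inv_cancel_left]
        exact fixes_dsum_one z j
    obtain ⟨x, rfl⟩ := hx
    rw [modifiedType_dsum_one] at h1
    rw [inv_dsum_one_mul, modifiedType_dsum_one] at h2
    exact ⟨⟨x, h1, h2⟩, rfl⟩

theorem numFact_eq {lam mu : PartFn Γ} {z : Wreath Γ m} {z' : Wreath Γ n}
    (hz : z.modifiedType = z'.modifiedType)
    (h : z.modifiedType.degree = lam.degree + mu.degree) :
    numFact lam mu z = numFact lam mu z' := by
  wlog hmn : m ≤ n generalizing m n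
  · exact (this hz.symm (hz ▸ h) (by omega)).symm
  obtain ⟨k, rfl⟩ := Nat.exists_eq_add_of_le hmn
  rw [← numFact_dsum_one (k := k) h]
  obtain ⟨t, ht⟩ := exists_conj_of_modifiedType_eq
    (x := dsum z (1 : Wreath Γ k)) (z := z') (by rw [modifiedType_dsum_one, hz])
  exact numFact_eq_of_mul_eq _ _ ht

open Classical in
theorem coeff_classSum (lam : PartFn Γ) (x : Wreath Γ n) :
    (classSum n lam).coeff x = if x.modifiedType = lam then 1 else 0 := rfl

theorem coeff_classSum_mul (lam mu : PartFn Γ) (z : Wreath Γ n) :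
    (classSum n lam * classSum n mu).coeff z = numFact lam mu z := by
  classical
  have := Fintype.ofFinite (Wreath Γ n)
  rw [coeff_mul_eq_sum, numFact, Nat.card_eq_fintype_card, Fintype.card_subtype, Finset.card_filter]
  push_cast
  refine Finset.sum_congr rfl fun x _ => ?_
  rw [coeff_classSum, coeff_classSum]
  split_ifs <;> simp_all

theorem classSum_mul_comm (lam mu : PartFn Γ) :
    classSum n lam * classSum n mu = classSum n mu * classSum n lam := by
  ext z
  rw [coeff_classSum_mul, coeff_classSum_mul, numFact_comm]

theorem degree_le_of_numFact_ne_zero {lam mu : PartFn Γ} {z : Wreath Γ n}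
    (h : numFact lam mu z ≠ 0) : z.modifiedType.degree ≤ lam.degree + mu.degree := by
  obtain ⟨⟨x, rfl, rfl⟩⟩ := (Nat.card_ne_zero.1 h).1
  simpa using degree_mul_le x (x⁻¹ * z)

end Wreath

/-! ### The commutative ring structure -/

namespace FHRing

open Wreath

variable {Γ : Type*} [Group Γ] [Finite Γ] {n : ℕ}

theorem const_eq_numFact {lam mu nu : PartFn Γ} (h : nu.degree = lam.degree + mu.degree)
    {z : Wreath Γ n} (hz : z.modifiedType = nu) : const lam mu nu = numFact lam mu z := by
  have hex := exists_modifiedType_eq nu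
  rw [const, classConst, dif_pos hex, coeff_classSum_mul]
  exact congrArg _ (numFact_eq (hex.choose_spec.trans hz.symm) ((congrArg _ hex.choose_spec).trans h))

theorem const_comm {lam mu nu : PartFn Γ} (h : nu.degree = lam.degree + mu.degree) :
    const lam mu nu = const mu lam nu := by
  obtain ⟨z, hz⟩ := exists_modifiedType_eq nu
  rw [const_eq_numFact h hz, const_eq_numFact (h.trans (add_comm _ _)) hz, numFact_comm]

/-- The intermediate products `t = x * y` are grouped by type. Restricting to types of top degree
loses nothing: subadditivity bounds the degree of `t` from above by `‖lam‖ + ‖mu‖`, and from below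
since `z` has the full degree. -/
theorem sum_const_mul_const {lam mu nu rho : PartFn Γ}
    (h : rho.degree = lam.degree + mu.degree + nu.degree) {z : Wreath Γ n}
    (hz : z.modifiedType = rho) :
    ∑ tau ∈ PartFn.ofDegree Γ (lam.degree + mu.degree), const lam mu tau * const tau nu rho =
      (classSum n lam * classSum n mu * classSum n nu).coeff z := by
  classical
  have := Fintype.ofFinite (Wreath Γ n)
  have h1 : ∀ tau ∈ PartFn.ofDegree Γ (lam.degree + mu.degree),
      const lam mu tau * const tau nu rho =
        ∑ t : Wreath Γ n, if t.modifiedType = tau then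
          const lam mu tau * (classSum n nu).coeff (t⁻¹ * z) else 0 := by
    intro tau htau
    rw [PartFn.mem_ofDegree] at htau
    rw [const_eq_numFact (lam := tau) (by rw [h, htau]) hz, ← coeff_classSum_mul, coeff_mul_eq_sum,
      Finset.mul_sum]
    refine Finset.sum_congr rfl fun t _ => ?_
    rw [coeff_classSum]
    split_ifs <;> simp
  rw [Finset.sum_congr rfl h1, Finset.sum_comm, coeff_mul_eq_sum]
  refine Finset.sum_congr rfl fun t _ => ?_
  rw [Finset.sum_ite_eq, coeff_classSum_mul]
  simp only [PartFn.mem_ofDegree]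
  split_ifs with hd
  · rw [const_eq_numFact hd rfl]
  · symm
    rw [mul_eq_zero, or_iff_not_imp_left]
    intro h2
    have h3 := degree_le_of_numFact_ne_zero (by exact_mod_cast h2)
    rw [coeff_classSum, if_neg]
    intro h4
    have h5 := degree_mul_le t (t⁻¹ * z)
    rw [mul_inv_cancel_left, hz, h4, h] at h5
    omega

theorem basisMul_apply (lam mu nu : PartFn Γ) : basisMul lam mu nu =
    open Classical in if nu.degree = lam.degree + mu.degree then const lam mu nu else 0 := by
  classical
  rw [basisMul, Finsupp.finsetSum_apply]
  simp only [Finsupp.single_apply, Finset.sum_ite_eq', PartFn.mem_ofDegree]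

theorem basisMul_comm (lam mu : PartFn Γ) : basisMul lam mu = basisMul mu lam := by
  ext nu
  rw [basisMul_apply, basisMul_apply, add_comm mu.degree]
  split_ifs with h
  · exact const_comm h
  · rfl

theorem mulHom_single (lam mu : PartFn Γ) (a b : ℤ) :
    mulHom Γ (Finsupp.single lam a) (Finsupp.single mu b) = (a * b) • basisMul lam mu := by
  simp [mulHom, Finsupp.linearCombination_single, smul_smul, mul_comm]

theorem mulHom_basisMul (lam mu nu rho : PartFn Γ) :
    mulHom Γ (basisMul lam mu) (Finsupp.single nu 1) rho =
      open Classical in if rho.degree = lam.degree + mu.degree + nu.degree then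
        ∑ tau ∈ PartFn.ofDegree Γ (lam.degree + mu.degree), const lam mu tau * const tau nu rho
      else 0 := by
  rw [basisMul, map_sum, LinearMap.sum_apply, Finsupp.finsetSum_apply]
  have : ∀ tau ∈ PartFn.ofDegree Γ (lam.degree + mu.degree),
      (mulHom Γ (Finsupp.single tau (const lam mu tau)) (Finsupp.single nu 1)) rho =
      open Classical in if rho.degree = lam.degree + mu.degree + nu.degree then
        const lam mu tau * const tau nu rho else 0 := by
    intro tau htau
    rw [PartFn.mem_ofDegree] at htau
    rw [mulHom_single, Finsupp.smul_apply, basisMul_apply, htau, mul_one, smul_eq_mul, mul_ite,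
      mul_zero]
  rw [Finset.sum_congr rfl this]
  split_ifs <;> simp

theorem mulHom_comm (a b : PartFn Γ →₀ ℤ) : mulHom Γ a b = mulHom Γ b a := by
  induction a using Finsupp.induction_linear with
  | zero => simp
  | add f g hf hg => rw [map_add, map_add, LinearMap.add_apply, hf, hg]
  | single lam r =>
    induction b using Finsupp.induction_linear with
    | zero => simp
    | add f g hf hg => rw [map_add, map_add, LinearMap.add_apply, hf, hg]
    | single mu s => rw [mulHom_single, mulHom_single, basisMul_comm, mul_comm]

/-- This cyclic form of associativity keeps the composite product on the left on both sides; with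
commutativity it is equivalent to the usual one. Both sides are coefficients of one triple product
in `ℤ[Γ_n]`. -/
theorem mulHom_basisMul_assoc (lam mu nu : PartFn Γ) :
    mulHom Γ (basisMul lam mu) (Finsupp.single nu 1) =
      mulHom Γ (basisMul mu nu) (Finsupp.single lam 1) := by
  ext rho
  rw [mulHom_basisMul, mulHom_basisMul]
  have h0 : lam.degree + mu.degree + nu.degree = mu.degree + nu.degree + lam.degree := by omega
  rw [← h0]
  split_ifs with h
  · obtain ⟨z, hz⟩ := exists_modifiedType_eq rho
    rw [sum_const_mul_const h hz, sum_const_mul_const (h.trans h0) hz,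
      mul_assoc (classSum _ mu), classSum_mul_comm nu lam, ← mul_assoc, classSum_mul_comm mu lam]
  · rfl

theorem mulHom_assoc (a b c : PartFn Γ →₀ ℤ) :
    mulHom Γ (mulHom Γ a b) c = mulHom Γ a (mulHom Γ b c) := by
  induction a using Finsupp.induction_linear with
  | zero => simp
  | add f g hf hg => simp only [map_add, LinearMap.add_apply, hf, hg]
  | single lam r =>
    induction b using Finsupp.induction_linear with
    | zero => simp
    | add f g hf hg => simp only [map_add, LinearMap.add_apply, hf, hg]
    | single mu s =>
      induction c using Finsupp.induction_linear with
      | zero => simp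
      | add f g hf hg => simp only [map_add, hf, hg]
      | single nu t =>
        have h : ∀ (rho : PartFn Γ) (w : ℤ), Finsupp.single rho w = w • Finsupp.single rho 1 :=
          fun rho w => by simp
        rw [mulHom_single, mulHom_single, h nu, h lam, map_smul, map_smul, map_smul, map_smul,
          LinearMap.smul_apply, LinearMap.smul_apply, mulHom_basisMul_assoc,
          mulHom_comm (Finsupp.single lam 1)]
        simp only [smul_smul]
        congr 1
        ring

theorem basisMul_zero (mu : PartFn Γ) : basisMul 0 mu = Finsupp.single mu 1 := by
  classical
  ext nu
  rw [basisMul_apply, PartFn.degree_zero, zero_add, Finsupp.single_apply]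
  split_ifs with h h' h'
  · subst h'
    obtain ⟨z, hz⟩ := exists_modifiedType_eq mu
    rw [const_eq_numFact (by simp) hz, numFact]
    norm_cast
    rw [Nat.card_eq_one_iff_unique]
    simp only [modifiedType_eq_zero_iff]
    refine ⟨⟨fun x y => Subtype.ext (x.2.1.trans y.2.1.symm)⟩, ⟨1, rfl, by simpa using hz⟩⟩
  · obtain ⟨z, hz⟩ := exists_modifiedType_eq nu
    rw [const_eq_numFact (by simpa using h) hz, numFact]
    norm_cast
    refine Nat.card_eq_zero.2 (Or.inl ⟨?_⟩)
    rintro ⟨x, h1, h2⟩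
    rw [modifiedType_eq_zero_iff.1 h1] at h2
    rw [inv_one, one_mul] at h2
    exact h' (h2.symm.trans hz)
  · exact absurd (congrArg _ h'.symm) h
  · rfl

theorem mulHom_one (a : PartFn Γ →₀ ℤ) : mulHom Γ (Finsupp.single 0 1) a = a := by
  induction a using Finsupp.induction_linear with
  | zero => simp
  | add f g hf hg => rw [map_add, hf, hg]
  | single lam r => rw [mulHom_single, basisMul_zero]; simp

/-- The Farahat-Higman ring. -/
abbrev commRing (Γ : Type*) [Group Γ] [Finite Γ] : CommRing (FHRing Γ) :=
  letI := addMul Γ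
  { addMul Γ with
    one := K 0
    mul_assoc := mulHom_assoc
    mul_comm := mulHom_comm
    one_mul := mulHom_one
    mul_one := fun a => (mulHom_comm a _).trans (mulHom_one a) }

end FHRing

/-! ### Indecomposability of the `(r)_c` -/

namespace PartFn

variable {Γ : Type*} [Group Γ]

theorem add_eq_zero_iff' {t u : PartFn Γ} : t + u = 0 ↔ t = 0 ∧ u = 0 := by
  refine ⟨fun h => ?_, by rintro ⟨rfl, rfl⟩; simp⟩
  have h1 : ∀ c, t.part c = 0 ∧ u.part c = 0 := fun c => by
    have := congrArg (fun ρ => ρ.part c) h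
    simpa [add_eq_zero] using this
  exact ⟨PartFn.ext (funext fun c => (h1 c).1), PartFn.ext (funext fun c => (h1 c).2)⟩

theorem eq_zero_of_sum_eq_zero {ι : Type*} {s : Finset ι} {f : ι → PartFn Γ}
    (h : ∑ i ∈ s, f i = 0) {i : ι} (hi : i ∈ s) : f i = 0 := by
  classical
  rw [← Finset.add_sum_erase s f hi] at h
  exact (add_eq_zero_iff'.1 h).1

theorem single_ne_zero (c : ConjClasses Γ) (r : ℕ+) : single c r ≠ 0 := by
  intro h
  have := congrArg (fun ρ => ρ.part c) h
  simp at this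

theorem eq_zero_or_eq_zero_of_add_eq_single {t u : PartFn Γ} {c : ConjClasses Γ} {r : ℕ+}
    (h : t + u = single c r) : t = 0 ∨ u = 0 := by
  have h1 : ∀ c', c' ≠ c → t.part c' = 0 ∧ u.part c' = 0 := fun c' hc => by
    have := congrArg (fun ρ => ρ.part c') h
    simpa [single_part_of_ne hc, add_eq_zero] using this
  have h2 : t.part c = 0 ∨ u.part c = 0 := by
    have := congrArg (fun ρ => Multiset.card (ρ.part c)) h
    simp only [add_part, Multiset.card_add, single_part_self, Multiset.card_singleton] at this
    rw [← Multiset.card_eq_zero, ← Multiset.card_eq_zero]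
    omega
  refine h2.imp (fun h2 => ?_) fun h2 => ?_
  all_goals
    ext c' : 2
    by_cases hc : c' = c
    · rw [hc, h2, zero_part]
    · simp [h1 c' hc]

theorem degree_eq_size {t : PartFn Γ} {c : ConjClasses Γ} (h : ∀ c', c' ≠ c → t.part c' = 0) :
    t.degree = (t.part c).size := by
  rw [degree, finsum_eq_single _ c fun c' hc => by simp [h c' hc]]

end PartFn

namespace Wreath

variable {Γ : Type*} [Group Γ] {n : ℕ}

/-! ### Products with a cycle -/

theorem Invariant.mul {x y : Wreath Γ n} {A : Set (Fin n)} (hx : x.Invariant A)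
    (hy : y.Invariant A) : (x * y).Invariant A := fun i => by
  rw [SemidirectProduct.mul_right, Equiv.Perm.mul_apply, hx, hy]

theorem Invariant.compl {x : Wreath Γ n} {A : Set (Fin n)} (hx : x.Invariant A) :
    x.Invariant Aᶜ := fun i => not_congr (hx i)

theorem invariant_of_fixSet {x : Wreath Γ n} {f : Fin n → WithZero Γ} (hf : f ∈ x.fixSet) :
    x.Invariant {i | f i ≠ 0} := fun i => by
  simp [hf i]

theorem Fixes.invariant_compl {x : Wreath Γ n} {i : Fin n} (h : x.Fixes i) :
    x.Invariant {i}ᶜ := by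
  refine Invariant.compl fun j => ?_
  rw [Set.mem_singleton_iff, Set.mem_singleton_iff]
  exact ⟨fun h1 => x.right.injective (h1.trans h.1.symm), fun h1 => h1 ▸ h.1⟩

theorem invariant_sameCycle (x : Wreath Γ n) (i : Fin n) :
    x.Invariant {j | x.right.SameCycle i j} := fun _ => Equiv.Perm.sameCycle_apply_right

/-- The orbit of `s` under the permutation parts of `x` and `y`. -/
def component (x y : Wreath Γ n) (s : Fin n) : Set (Fin n) :=
  {i | ∀ A, x.Invariant A → y.Invariant A → s ∈ A → i ∈ A}

section component

variable {x y : Wreath Γ n} {s : Fin n}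

theorem mem_component_self : s ∈ component x y s := fun _ _ _ h => h

theorem invariant_component_left : x.Invariant (component x y s) := fun i =>
  forall_congr' fun _ => forall_congr' fun hx => forall_congr' fun _ => forall_congr' fun _ => hx i

theorem invariant_component_right : y.Invariant (component x y s) := fun i =>
  forall_congr' fun _ => forall_congr' fun _ => forall_congr' fun hy => forall_congr' fun _ => hy i

theorem component_subset {A : Set (Fin n)} (hx : x.Invariant A) (hy : y.Invariant A) (hs : s ∈ A) :
    component x y s ⊆ A := fun _ hi => hi A hx hy hs

theorem component_subset_of_mem {A : Set (Fin n)} (hx : x.Invariant A) (hy : y.Invariant A)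
    {i : Fin n} (hi : i ∈ component x y s) (hiA : i ∈ A) : component x y s ⊆ A := by
  refine component_subset hx hy ?_
  by_contra hs
  exact component_subset hx.compl hy.compl hs hi hiA

end component

theorem typeOn_congr {x y : Wreath Γ n} {A : Set (Fin n)} (hA : y.Invariant A)
    (h : ∀ i ∈ A, x.right i = y.right i ∧ gain x i = gain y i) : x.typeOn A = y.typeOn A := by
  have hy : ∀ i ∈ A, ∀ k : ℕ, (y.right ^ k) i ∈ A := fun i hi k =>
    (hA.mem_iff (Equiv.Perm.sameCycle_pow_right.2 (.refl _ _))).1 hi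
  have hpow : ∀ i ∈ A, ∀ k : ℕ, (x.right ^ k) i = (y.right ^ k) i ∧
      gain (x ^ k) i = gain (y ^ k) i := by
    intro i hi k
    induction k with
    | zero => simp
    | succ k ih =>
      have h1 := h _ (hy i hi k)
      simp only [pow_succ', Equiv.Perm.mul_apply, gain_mul, right_pow, ih.1, ih.2, h1.1, h1.2,
        and_self]
  have hs : ∀ i ∈ A, ∀ j, x.right.SameCycle i j ↔ y.right.SameCycle i j := by
    intro i hi j
    constructor
    · intro hij
      obtain ⟨k, rfl⟩ := hij.exists_nat_pow_eq
      exact ⟨k, by rw [zpow_natCast, (hpow i hi k).1]⟩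
    · intro hij
      obtain ⟨k, rfl⟩ := hij.exists_nat_pow_eq
      exact ⟨k, by rw [zpow_natCast, (hpow i hi k).1]⟩
  have hl : ∀ i ∈ A, x.cycleLength i = y.cycleLength i := by
    intro i hi
    rw [cycleLength, cycleLength, Function.minimalPeriod_eq_minimalPeriod_iff]
    intro k
    rw [Function.IsPeriodicPt, Function.IsPeriodicPt, Function.IsFixedPt, Function.IsFixedPt,
      ← Equiv.Perm.coe_pow, ← Equiv.Perm.coe_pow, (hpow i hi k).1]
  have hr : x.repsOn A = y.repsOn A := by
    ext i
    rw [mem_repsOn, mem_repsOn]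
    refine and_congr_left fun hi => ?_
    rw [mem_reps, mem_reps]
    exact forall_congr' fun j => by rw [hs i hi j]
  rw [typeOn, typeOn, hr]
  refine Finset.sum_congr rfl fun i hi => ?_
  have hi := (mem_repsOn.1 hi).2
  rw [cycleType, cycleType, cycleClass_eq, cycleClass_eq, hl i hi, (hpow i hi _).2]

theorem typeOn_eq_zero {x : Wreath Γ n} {A : Set (Fin n)} (h : ∀ i ∈ A, x.Fixes i) :
    x.typeOn A = 0 :=
  Finset.sum_eq_zero fun i hi => cycleType_eq_zero.2 (h i (mem_repsOn.1 hi).2)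

theorem typeOn_part_eq_zero {x : Wreath Γ n} {A : Set (Fin n)} {c : ConjClasses Γ}
    (h : ∀ i ∈ A, x.cycleClass i ≠ c) : (x.typeOn A).part c = 0 := by
  rw [typeOn, PartFn.sum_part]
  exact Finset.sum_eq_zero fun i hi => if_neg (h i (mem_repsOn.1 hi).2)

/-- An element with a single nontrivial cycle. -/
theorem exists_cycle_of_modifiedType_eq_single {x : Wreath Γ n} {c : ConjClasses Γ} {r : ℕ+}
    (h : x.modifiedType = PartFn.single c r) : ∃ s, x.cycleType s = PartFn.single c r ∧
      ∀ i, ¬ x.Fixes i → x.right.SameCycle s i := by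
  classical
  obtain ⟨s, hs, h1⟩ : ∃ s ∈ x.reps, x.cycleType s ≠ 0 := by
    by_contra! h0
    exact PartFn.single_ne_zero c r (by rw [← h, modifiedType_eq_sum, Finset.sum_eq_zero h0])
  rw [modifiedType_eq_sum, ← Finset.add_sum_erase _ _ hs] at h
  have h2 := (PartFn.eq_zero_or_eq_zero_of_add_eq_single h).resolve_left h1
  refine ⟨s, by rwa [h2, add_zero] at h, fun i hi => ?_⟩
  rw [← cycleType_eq_zero, ← cycleType_eq_of_sameCycle (sameCycle_rep x i)] at hi
  have h3 : x.rep i = s := by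
    by_contra h3
    exact hi (PartFn.eq_zero_of_sum_eq_zero h2 (Finset.mem_erase.2 ⟨h3, rep_mem x i⟩))
  exact h3 ▸ (sameCycle_rep x i).symm

theorem cycleClass_and_cycleLength_of_cycleType_eq_single {x : Wreath Γ n} {i : Fin n}
    {c : ConjClasses Γ} {r : ℕ+} (h : x.cycleType i = PartFn.single c r) :
    x.cycleClass i = c ∧ x.cycleLength i = cycleLengthOfPart c r := by
  have := count_cycleType x i c r
  rw [h, PartFn.single_part_self, Multiset.count_singleton_self] at this
  by_contra h0
  rw [if_neg h0] at this
  exact one_ne_zero this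

variable [Finite Γ]

/-- The lower bound on the number of fixed functions makes restriction to the balanced
representatives bijective, so some fixed function takes the value `1` at all of them. -/
theorem exists_fixSet_ne_zero {x : Wreath Γ n} {i : Fin n}
    (h : x.cycleClass i = ConjClasses.mk 1) : ∃ f ∈ x.fixSet, f i ≠ 0 := by
  have h1 := le_card_fixSet_inter x 1
  have h2 : (1 : Wreath Γ n).fixSet = Set.univ := by ext; simp [fixSet]
  have h3 : Nat.card (WithZero Γ) ^ n = _ :=
    congrArg (Nat.card (WithZero Γ) ^ ·) (degree_modifiedType_add_card x).symm
  rw [h2, Set.inter_univ, modifiedType_one, PartFn.degree_zero, add_zero, h3, pow_add] at h1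
  have h4 := Nat.le_of_mul_le_mul_left h1 (pow_pos (one_lt_card_withZero.trans' one_pos) _)
  rw [← card_balancedReps_fun] at h4
  have hF := (injective_restrict_balancedReps x).bijective_of_nat_card_le h4
  obtain ⟨f, hf⟩ := hF.surjective 1
  refine ⟨f.1, f.2, fun hi => ?_⟩
  have h5 : f.1 (x.rep i) = 1 := congrFun hf ⟨x.rep i, mem_balancedReps.2 ⟨rep_mem x i, by
    rw [cycleClass_eq_of_sameCycle (sameCycle_rep x i), h]⟩⟩
  have h6 := (fixSet_eq_iff_of_sameCycle f.2 (zero_mem_fixSet x) (sameCycle_rep x i)).1 hi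
  rw [h5] at h6
  exact one_ne_zero h6

/-- Off the orbit `O` of the nontrivial cycle of `x`, the product agrees with `y`; only `O` matters,
and there the degrees still add up. The alternative is whether `x * y` has a balanced cycle on `O`.
-/
theorem single_add_le_modifiedType_mul {x y : Wreath Γ n} {c : ConjClasses Γ} {r : ℕ+}
    (hx : x.modifiedType = PartFn.single c r)
    (hd : (x * y).modifiedType.degree = x.modifiedType.degree + y.modifiedType.degree) :
    PartFn.single c r + y.modifiedType ≤ (x * y).modifiedType := by
  classical
  obtain ⟨s, hs, hmoved⟩ := exists_cycle_of_modifiedType_eq_single hx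
  obtain ⟨hsc, hsl⟩ := cycleClass_and_cycleLength_of_cycleType_eq_single hs
  have hsF : ¬ x.Fixes s := by
    rw [← cycleType_eq_zero, hs]
    exact PartFn.single_ne_zero c r
  set O := component x y s with hO
  have hxO : x.Invariant O := invariant_component_left
  have hyO : y.Invariant O := invariant_component_right
  have hzO : (x * y).Invariant O := hxO.mul hyO
  have hxc : ∀ i ∈ Oᶜ, x.Fixes i := fun i hi => by
    by_contra h
    exact hi ((hxO.mem_iff (hmoved i h)).1 mem_component_self)
  have hxO' : x.typeOn O = PartFn.single c r := by
    rw [← hx, ← typeOn_add_typeOn_compl x O, typeOn_eq_zero hxc, add_zero]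
  have hzc : (x * y).typeOn Oᶜ = y.typeOn Oᶜ := by
    refine typeOn_congr hyO.compl fun i hi => ?_
    have := hxc _ ((hyO.compl i).2 hi)
    rw [SemidirectProduct.mul_right, Equiv.Perm.mul_apply, gain_mul, this.1, this.2, one_mul]
    exact ⟨rfl, rfl⟩
  have hdeg : ((x * y).typeOn O).degree = r + (y.typeOn O).degree := by
    rw [hx, ← typeOn_add_typeOn_compl (x * y) O, ← typeOn_add_typeOn_compl y O, hzc] at hd
    simp only [PartFn.degree_add, PartFn.degree_single] at hd
    omega
  suffices h : PartFn.single c r + y.typeOn O ≤ (x * y).typeOn O by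
    rw [← typeOn_add_typeOn_compl (x * y) O, ← typeOn_add_typeOn_compl y O, hzc, ← add_assoc]
    exact PartFn.add_le_add_right' h _
  have hfix := fixSet_mul_eq hd
  -- The support of `f` is invariant under both factors because `f` is fixed by both; a jointly
  -- invariant set that meets the orbit contains it.
  have hne : ∀ f ∈ (x * y).fixSet, ∀ i ∈ O, f i ≠ 0 → ∀ j ∈ O, f j ≠ 0 := by
    intro f hf i hi hfi
    rw [hfix] at hf
    exact component_subset_of_mem (invariant_of_fixSet hf.1) (invariant_of_fixSet hf.2) hi hfi
  by_cases hbal : ∃ i ∈ O, (x * y).cycleClass i = ConjClasses.mk 1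
  · obtain ⟨i, hi, hci⟩ := hbal
    obtain ⟨f, hf, hfi⟩ := exists_fixSet_ne_zero hci
    have hf0 := hne f hf i hi hfi
    have hfxy := hf
    rw [hfix] at hfxy
    have hc1 : c = ConjClasses.mk 1 := by
      rw [← hsc]
      exact cycleClass_eq_one_of_fixSet hfxy.1 (hf0 s mem_component_self)
    subst hc1
    have hcyc : ∀ j ∈ O, (x * y).right.SameCycle i j := by
      -- Cutting `f` down to a single cycle of `x * y` keeps it fixed, yet its support must be all
      -- of `O`; hence this cycle is `O`.
      let f' : Fin n → WithZero Γ := fun j => if (x * y).right.SameCycle i j then f j else 0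
      have hf' : f' ∈ (x * y).fixSet := by
        intro j
        simp only [f', Equiv.Perm.sameCycle_apply_right]
        split_ifs
        · exact hf j
        · simp
      have h1 := hne f' hf' i hi (by simpa [f', Equiv.Perm.SameCycle.refl] using hfi)
      intro j hj
      by_contra h2
      exact h1 j hj (if_neg h2)
    have hz : (x * y).typeOn O = (x * y).cycleType i := by
      have : (x * y).repsOn O = {(x * y).rep i} := by
        ext j
        rw [mem_repsOn, Finset.mem_singleton]
        constructor
        · rintro ⟨h1, h2⟩
          exact ((rep_eq_iff h1).2 (hcyc j h2)).symm
        · rintro rfl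
          exact ⟨rep_mem _ _, (hzO.mem_iff (sameCycle_rep _ i)).1 hi⟩
      rw [typeOn, this, Finset.sum_singleton, cycleType_eq_of_sameCycle (sameCycle_rep _ i)]
    have hz0 : ∀ c', c' ≠ ConjClasses.mk 1 → ((x * y).typeOn O).part c' = 0 := by
      intro c' hc'
      refine typeOn_part_eq_zero fun j hj => ?_
      rw [cycleClass_eq_one_of_fixSet hf (hf0 j hj)]
      exact hc'.symm
    have hy0 : ∀ c', c' ≠ ConjClasses.mk 1 → (y.typeOn O).part c' = 0 := by
      intro c' hc'
      refine typeOn_part_eq_zero fun j hj => ?_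
      rw [cycleClass_eq_one_of_fixSet hfxy.2 (hf0 j hj)]
      exact hc'.symm
    have hzd := PartFn.degree_eq_size hz0
    have hyd := PartFn.degree_eq_size hy0
    -- All types on `O` are concentrated at the class of `1`, and the product has one part there,
    -- which dominates every partition of the same size.
    refine PartFn.Step.le ⟨by rw [PartFn.degree_add, PartFn.degree_single, hdeg],
      Or.inr fun c' => ?_⟩
    by_cases hc' : c' = ConjClasses.mk 1
    · subst hc'
      have h1 : ∃ k : ℕ+, ((x * y).typeOn O).part (ConjClasses.mk 1) = {k} := by
        have h2 : ((x * y).typeOn O).part (ConjClasses.mk 1) =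
            Partn.ofNat ((x * y).cycleLength i - 1) := by
          rw [hz]
          simp [cycleType, hci]
        rw [h2, Partn.size_ofNat] at hzd
        have := r.pos
        rw [h2, Partn.ofNat, if_pos (by omega)]
        exact ⟨_, rfl⟩
      obtain ⟨k, hk⟩ := h1
      rw [hk]
      refine Partn.dominates_singleton ?_
      rw [PartFn.add_part, Partn.size_add, PartFn.single_part_self, Partn.size_singleton, ← hyd,
        ← hdeg, hzd, hk, Partn.size_singleton]
    · rw [PartFn.add_part, hz0 c' hc', hy0 c' hc', PartFn.single_part_of_ne hc']
      exact Partn.Dominates.rfl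
  · push Not at hbal
    have hz0 : ((x * y).typeOn O).part (ConjClasses.mk 1) = 0 := typeOn_part_eq_zero hbal
    by_cases h0 : (PartFn.single c r + y.typeOn O).part (ConjClasses.mk 1) = 0
    · rw [PartFn.add_part, add_eq_zero] at h0
      have hc1 : c ≠ ConjClasses.mk 1 := by
        rintro rfl
        simp at h0
      rw [cycleLengthOfPart, if_neg hc1] at hsl
      have hyF : ∀ i ∈ y.balancedReps, i ∈ O → y.Fixes i := by
        intro i hi hiO
        obtain ⟨hir, hic⟩ := mem_balancedReps.1 hi
        rw [← cycleLength_eq_one_and_cycleClass]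
        refine ⟨?_, hic⟩
        have h1 : (y.cycleType i).part (ConjClasses.mk 1) = 0 := by
          have h2 := h0.2
          rw [typeOn, PartFn.sum_part, ← Finset.add_sum_erase _ _ (mem_repsOn.2 ⟨hir, hiO⟩),
            add_eq_zero] at h2
          exact h2.1
        have h3 := congrArg Partn.size h1
        simp only [cycleType, hic, if_true, Partn.size_ofNat, Partn.size_zero] at h3
        have := cycleLength_pos y i
        omega
      -- A point other than `s` that both `x` and `y` fix could be removed from `O`, against
      -- minimality. So the balanced points of `y` on `O` lie on the cycle of `x`.
      have hb : y.balancedReps.filter (· ∈ O) ⊆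
          Finset.univ.filter fun j => x.right.SameCycle s j := by
        intro i hi
        obtain ⟨hi, hiO⟩ := Finset.mem_filter.1 hi
        rw [Finset.mem_filter]
        refine ⟨Finset.mem_univ _, hmoved i fun hxi => ?_⟩
        exact component_subset hxi.invariant_compl (hyF i hi hiO).invariant_compl
          (fun hsi : s = i => hsF (hsi ▸ hxi)) hiO rfl
      -- The product has degree `|O|` on `O` and `y` has degree `|O|` minus this number, while the
      -- difference of degrees is `r`, here the length of the cycle of `x`. Therefore `y` fixes that
      -- whole cycle, which is then `O`.
      have hcard : (y.balancedReps.filter (· ∈ O)).card = r := by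
        have h1 := degree_typeOn_add_card (x * y) hzO
        have h2 := degree_typeOn_add_card y hyO
        have h3 : (x * y).balancedReps.filter (· ∈ O) = ∅ := by
          rw [Finset.filter_eq_empty_iff]
          intro i hi hiO
          exact hbal i hiO (mem_balancedReps.1 hi).2
        rw [h3, Finset.card_empty] at h1
        omega
      have heq := Finset.eq_of_subset_of_card_le hb (by rw [hcard, card_filter_sameCycle, hsl])
      have hyS : ∀ j, x.right.SameCycle s j → y.Fixes j := by
        intro j hj
        have : j ∈ y.balancedReps.filter (· ∈ O) := by
          rw [heq, Finset.mem_filter]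
          exact ⟨Finset.mem_univ _, hj⟩
        exact hyF j (Finset.mem_filter.1 this).1 (Finset.mem_filter.1 this).2
      have hOF : ∀ j ∈ O, y.Fixes j := by
        have : y.Invariant {j | x.right.SameCycle s j} := by
          intro j
          constructor
          · intro hj
            rwa [← y.right.injective (hyS _ hj).1]
          · intro hj
            rwa [(hyS j hj).1]
        exact fun j hj => hyS j (component_subset (invariant_sameCycle x s) this (.refl _ _) hj)
      rw [typeOn_eq_zero hOF, add_zero, ← hxO']
      refine (typeOn_congr hxO fun i hi => ?_).ge
      rw [SemidirectProduct.mul_right, Equiv.Perm.mul_apply, gain_mul, (hOF i hi).1, (hOF i hi).2,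
        mul_one]
      exact ⟨rfl, rfl⟩
    -- The product has no part left at the class of `1`, while the factors had some: the first
    -- generating relation applies.
    · refine PartFn.Step.le ⟨by rw [PartFn.degree_add, PartFn.degree_single, hdeg], Or.inl ?_⟩
      rw [hz0]
      exact pos_iff_ne_zero.2 h0

end Wreath

namespace FHRing

open Wreath

variable {Γ : Type*} [Group Γ] [Finite Γ]

/-! ### Triangularity -/

theorem const_nonneg {lam mu nu : PartFn Γ} (h : nu.degree = lam.degree + mu.degree) :
    0 ≤ const lam mu nu := by
  obtain ⟨z, hz⟩ := exists_modifiedType_eq nu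
  rw [const_eq_numFact h hz]
  exact Int.natCast_nonneg _

theorem basisMul_nonneg (lam mu nu : PartFn Γ) : 0 ≤ basisMul lam mu nu := by
  rw [basisMul_apply]
  split_ifs with h
  · exact const_nonneg h
  · exact le_rfl

theorem single_add_le_of_basisMul_ne_zero {c : ConjClasses Γ} {r : ℕ+} {lam nu : PartFn Γ}
    (h : basisMul (PartFn.single c r) lam nu ≠ 0) : PartFn.single c r + lam ≤ nu := by
  rw [basisMul_apply] at h
  split_ifs at h with hd
  · obtain ⟨z, hz⟩ := exists_modifiedType_eq nu
    rw [const_eq_numFact hd hz] at h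
    obtain ⟨⟨x, hx, hy⟩⟩ := (Nat.card_ne_zero.1 (by exact_mod_cast h)).1
    have := single_add_le_modifiedType_mul (y := x⁻¹ * z) hx
      (by rw [mul_inv_cancel_left, hx, hy, hz, hd])
    rwa [mul_inv_cancel_left, hy, hz] at this
  · exact absurd rfl h

/-- The witness is the factorization `x ⊕ y = (x ⊕ 1) * (1 ⊕ y)`. -/
theorem basisMul_add_pos (lam mu : PartFn Γ) : 0 < basisMul lam mu (lam + mu) := by
  have hd := PartFn.degree_add lam mu
  rw [basisMul_apply, if_pos hd]
  obtain ⟨x, hx⟩ := exists_modifiedType_eq lam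
  obtain ⟨y, hy⟩ := exists_modifiedType_eq mu
  rw [const_eq_numFact hd (z := dsum x y) (by rw [modifiedType_dsum, hx, hy])]
  refine Int.natCast_pos.2 (Nat.pos_of_ne_zero (Nat.card_ne_zero.2 ⟨⟨dsum x 1, ?_, ?_⟩, inferInstance⟩))
  · rw [modifiedType_dsum_one, hx]
  · have : (dsum x 1)⁻¹ * dsum x y = dsum 1 y := by
      rw [inv_mul_eq_iff_eq_mul, dsum_mul_dsum]
      simp
    rw [this, modifiedType_dsum, modifiedType_one, zero_add, hy]

/-- Induction step for triangularity: all structure constants are nonnegative, so nothing cancels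
the positive leading term, and monotonicity of the union controls the rest. -/
theorem exists_mulHom_single_eq {c : ConjClasses Γ} {r : ℕ+} {lam : PartFn Γ}
    {d : PartFn Γ →₀ ℕ} (hd : ∀ mu ∈ d.support, lam ≤ mu) (hpos : 0 < d lam) :
    ∃ d' : PartFn Γ →₀ ℕ, (∀ mu ∈ d'.support, PartFn.single c r + lam ≤ mu) ∧
      0 < d' (PartFn.single c r + lam) ∧
      mulHom Γ (Finsupp.single (PartFn.single c r) 1) (d.mapRange Nat.cast Nat.cast_zero) =
        d'.mapRange Nat.cast Nat.cast_zero := by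
  set w := mulHom Γ (Finsupp.single (PartFn.single c r) 1) (d.mapRange Nat.cast Nat.cast_zero)
    with hw
  have hwa : ∀ nu, w nu = ∑ mu ∈ d.support, (d mu : ℤ) * basisMul (PartFn.single c r) mu nu := by
    intro nu
    have h1 : d.mapRange (Nat.cast : ℕ → ℤ) Nat.cast_zero =
        ∑ mu ∈ d.support, Finsupp.single mu (d mu : ℤ) := by
      classical
      ext mu
      rw [Finsupp.mapRange_apply, Finsupp.finsetSum_apply]
      simp only [Finsupp.single_apply, Finset.sum_ite_eq', Finsupp.mem_support_iff]
      split_ifs with h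
      · rfl
      · simpa using h
    rw [hw, h1, map_sum, Finsupp.finsetSum_apply]
    refine Finset.sum_congr rfl fun mu _ => ?_
    rw [mulHom_single, one_mul, Finsupp.smul_apply, smul_eq_mul]
  have hterm : ∀ mu nu, 0 ≤ (d mu : ℤ) * basisMul (PartFn.single c r) mu nu := fun mu nu =>
    mul_nonneg (Int.natCast_nonneg _) (basisMul_nonneg _ _ _)
  have hw0 : ∀ nu, 0 ≤ w nu := fun nu => hwa nu ▸ Finset.sum_nonneg fun mu _ => hterm mu nu
  refine ⟨w.mapRange Int.toNat rfl, fun nu hnu => ?_, ?_, ?_⟩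
  · have h1 : w nu ≠ 0 := by
      intro h
      simp [h] at hnu
    rw [hwa] at h1
    obtain ⟨mu, hmu, h2⟩ := Finset.exists_ne_zero_of_sum_ne_zero h1
    refine le_trans ?_ (single_add_le_of_basisMul_ne_zero (right_ne_zero_of_mul h2))
    rw [add_comm, add_comm _ mu]
    exact PartFn.add_le_add_right' (hd mu hmu) _
  · rw [Finsupp.mapRange_apply, Int.lt_toNat, Nat.cast_zero, hwa]
    refine Finset.sum_pos' (fun mu _ => hterm mu _) ⟨lam, Finsupp.mem_support_iff.2 hpos.ne', ?_⟩
    exact mul_pos (by exact_mod_cast hpos) (basisMul_add_pos _ _)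
  · ext nu
    simp [hw0 nu]

end FHRing

/-! ### Triangular families of monomials -/

theorem MvPolynomial.aeval_eq_sum_toMultiset {σ R A : Type*} [CommRing R] [CommRing A]
    [Algebra R A] (v : σ → A)
    (p : MvPolynomial σ R) :
    aeval v p = ∑ m ∈ p.support, p.coeff m • ((Finsupp.toMultiset m).map v).prod := by
  rw [aeval_def, eval₂_eq]
  refine Finset.sum_congr rfl fun m _ => ?_
  rw [Algebra.smul_def, Finsupp.toMultiset_map, Finsupp.prod_toMultiset,
    Finsupp.prod_mapDomain_index (by simp) (by simp [pow_add])]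
  rfl

theorem Module.Basis.repr_sum_nsmul {ι R M : Type*} [Ring R] [AddCommGroup M] [Module R M]
    (b : Module.Basis ι R M) (d : ι →₀ ℕ) (i : ι) :
    b.repr (d.sum fun mu a => a • b mu) i = (d i : R) := by
  classical
  rw [map_finsuppSum, Finsupp.sum, Finsupp.finsetSum_apply]
  simp only [map_nsmul, Module.Basis.repr_self, Finsupp.smul_apply, Finsupp.single_apply, smul_ite,
    smul_zero, Finset.sum_ite_eq', Finsupp.mem_support_iff]
  split_ifs with h
  · simp
  · rw [not_not.1 h, Nat.cast_zero]

section Triangular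

variable {Γ : Type*} [Group Γ]

/-- The monomials in the family `v` are combinations of basis elements indexed by larger
partition-valued functions, with natural coefficients and positive leading coefficient. -/
def IsTriangular {A : Type*} [CommRing A] (b : PartFn Γ → A) (v : ConjClasses Γ × ℕ+ → A) : Prop :=
  ∀ M : Multiset (ConjClasses Γ × ℕ+), ∃ d : PartFn Γ →₀ ℕ,
    (∀ mu ∈ d.support, PartFn.ofParts Γ M ≤ mu) ∧ 0 < d (PartFn.ofParts Γ M) ∧
    (M.map v).prod = d.sum fun mu a => a • b mu

theorem IsTriangular.map {A B : Type*} [CommRing A] [CommRing B] {b : PartFn Γ → A}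
    {v : ConjClasses Γ × ℕ+ → A} (h : IsTriangular b v) (f : A →+* B) :
    IsTriangular (f ∘ b) (f ∘ v) := by
  intro M
  obtain ⟨d, h1, h2, h3⟩ := h M
  refine ⟨d, h1, h2, ?_⟩
  rw [← Multiset.map_map, Multiset.prod_hom, h3, map_finsuppSum]
  simp

variable {R A : Type*} [CommRing A]

/-- In a vanishing polynomial, choose a monomial whose index is minimal in the order. Every other
monomial involves only basis elements above its own index, so the coefficient at the minimal index
is a single nonzero product. -/
theorem IsTriangular.algebraicIndependent [CommRing R] [IsDomain R] [CharZero R] [Algebra R A]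
    {b : Module.Basis (PartFn Γ) R A} {v : ConjClasses Γ × ℕ+ → A} (h : IsTriangular b v) :
    AlgebraicIndependent R v := by
  rw [algebraicIndependent_iff]
  intro p hp
  by_contra hp0
  classical
  choose d h1 h2 h3 using h
  let L : (ConjClasses Γ × ℕ+ →₀ ℕ) → PartFn Γ := fun m => PartFn.ofParts Γ (Finsupp.toMultiset m)
  have hL : L.Injective :=
    PartFn.ofParts_injective.comp (Function.LeftInverse.injective Finsupp.toMultiset_toFinsupp)
  obtain ⟨m, hm, hmin⟩ := Finset.exists_minimalFor L p.support (MvPolynomial.support_nonempty.2 hp0)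
  have h4 := congrArg (fun a => b.repr a (L m)) hp
  simp only [MvPolynomial.aeval_eq_sum_toMultiset, map_sum, map_smul, h3, map_zero,
    Finsupp.finsetSum_apply, Finsupp.smul_apply, b.repr_sum_nsmul, Finsupp.zero_apply] at h4
  rw [Finset.sum_eq_single m] at h4
  · rcases smul_eq_zero.1 h4 with h5 | h5
    · exact MvPolynomial.mem_support_iff.1 hm h5
    · exact (h2 (Finsupp.toMultiset m)).ne' (by exact_mod_cast h5)
  · intro m' hm' hne
    rw [smul_eq_zero]
    right
    norm_cast
    by_contra h5
    have h6 := h1 _ _ (Finsupp.mem_support_iff.2 h5)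
    exact hne (hL (le_antisymm h6 (hmin hm' h6)))
  · exact fun h => absurd hm h

/-- Among the finitely many indices of one degree, take a maximal one whose basis element is missed.
Its monomial is a positive multiple of that element plus elements already reached, and the multiple
is invertible in a field of characteristic zero. -/
theorem IsTriangular.adjoin_eq_top [Finite Γ] [Field R] [CharZero R] [Algebra R A]
    {b : Module.Basis (PartFn Γ) R A} {v : ConjClasses Γ × ℕ+ → A} (h : IsTriangular b v) :
    Algebra.adjoin R (Set.range v) = ⊤ := by
  classical
  set S := Algebra.adjoin R (Set.range v) with hS
  have hb : ∀ lam, b lam ∈ S := by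
    by_contra! hne
    obtain ⟨lam0, h0⟩ := hne
    have hfin : {lam : PartFn Γ | lam.degree = lam0.degree ∧ b lam ∉ S}.Finite :=
      (PartFn.finite_degree lam0.degree).subset fun lam h => h.1
    obtain ⟨lam, hlam⟩ := hfin.exists_maximal ⟨lam0, rfl, h0⟩
    obtain ⟨⟨hdeg, hnot⟩, hmax⟩ := hlam
    obtain ⟨M, rfl⟩ := PartFn.ofParts_surjective lam
    obtain ⟨d, h1, h2, h3⟩ := h M
    set lam := PartFn.ofParts Γ M
    have hM : (M.map v).prod ∈ S := by
      refine Subalgebra.multiset_prod_mem S fun a ha => ?_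
      obtain ⟨p, -, rfl⟩ := Multiset.mem_map.1 ha
      exact Algebra.subset_adjoin ⟨p, rfl⟩
    rw [h3, Finsupp.sum, ← Finset.add_sum_erase _ _ (Finsupp.mem_support_iff.2 h2.ne')] at hM
    have hrest : ∑ mu ∈ d.support.erase lam, d mu • b mu ∈ S := by
      refine S.sum_mem fun mu hmu => S.nsmul_mem ?_ _
      obtain ⟨hne, hmu⟩ := Finset.mem_erase.1 hmu
      have hle := h1 mu hmu
      by_contra hnot'
      exact hne (le_antisymm
        (hmax ⟨(PartFn.degree_eq_of_le hle).symm.trans hdeg, hnot'⟩ hle) hle)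
    have h4 : d lam • b lam ∈ S := by simpa using S.sub_mem hM hrest
    have h5 := S.smul_mem h4 ((d lam : R)⁻¹)
    rw [← Nat.cast_smul_eq_nsmul R, smul_smul,
      inv_mul_cancel₀ (Nat.cast_ne_zero.2 h2.ne'), one_smul] at h5
    exact hnot h5
  rw [eq_top_iff]
  intro a _
  have : Submodule.span R (Set.range b) ≤ Subalgebra.toSubmodule S := by
    rw [Submodule.span_le]
    rintro _ ⟨lam, rfl⟩
    exact hb lam
  exact this (b.mem_span a)

end Triangular

/-! ### Triangularity in the Farahat–Higman ring and conclusion -/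

namespace FHRing

variable {Γ : Type*} [Group Γ] [Finite Γ]

/-- The basis `K_lam` of the Farahat-Higman ring. -/
def basis (Γ : Type*) [Group Γ] [Finite Γ] :
    letI := commRing Γ
    Module.Basis (PartFn Γ) ℤ (FHRing Γ) :=
  letI := commRing Γ
  .ofRepr (AddEquiv.toIntLinearEquiv
    { toFun := fun f => f, invFun := fun f => f, left_inv := fun _ => rfl,
      right_inv := fun _ => rfl, map_add' := fun _ _ => rfl })

theorem isTriangular_K :
    letI := commRing Γ
    IsTriangular (K (Γ := Γ)) fun p => K (PartFn.single p.1 p.2) := by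
  let := commRing Γ
  -- This identifies sums taken in the ring with finitely supported functions, the form in which the
  -- induction step is stated.
  have hcast : ∀ d : PartFn Γ →₀ ℕ, (d.sum fun mu a => a • K mu) =
      (d.mapRange Nat.cast Nat.cast_zero : PartFn Γ →₀ ℤ) := by
    intro d
    refine (basis Γ).ext_elem fun lam => ?_
    exact (basis Γ).repr_sum_nsmul d lam
  intro M
  induction M using Multiset.induction_on with
  | empty =>
    refine ⟨Finsupp.single 0 1, fun mu hmu => ?_, by simp, ?_⟩
    · have : mu = 0 := by
        by_contra h
        exact Finsupp.mem_support_iff.1 hmu (Finsupp.single_eq_of_ne h)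
      rw [this, map_zero]
    · rw [hcast, Finsupp.mapRange_single, Nat.cast_one]
      rfl
  | cons p M ih =>
    obtain ⟨d, h1, h2, h3⟩ := ih
    obtain ⟨d', h4, h5, h6⟩ := exists_mulHom_single_eq (c := p.1) (r := p.2) h1 h2
    refine ⟨d', by rwa [PartFn.ofParts_cons], by rwa [PartFn.ofParts_cons], ?_⟩
    rw [Multiset.map_cons, Multiset.prod_cons, h3, hcast, hcast]
    exact h6

theorem exists_finprod_eq (lam : PartFn Γ) :
    letI := commRing Γ
    ∃ d : PartFn Γ →₀ ℕ, (∀ mu ∈ d.support, lam ≤ mu) ∧ 0 < d lam ∧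
      ∏ᶠ c : ConjClasses Γ, ((lam.part c).map fun r => K (PartFn.single c r)).prod
        = d.sum fun mu a => a • K mu := by
  let := commRing Γ
  have := Fintype.ofFinite (ConjClasses Γ)
  obtain ⟨d, h1, h2, h3⟩ := isTriangular_K (∑ c, (lam.part c).map fun r => (c, r))
  rw [PartFn.ofParts_sum_map] at h1 h2
  refine ⟨d, h1, h2, ?_⟩
  rw [← h3, finprod_eq_prod_of_fintype, ← Multiset.coe_mapAddMonoidHom, map_sum,
    Multiset.prod_sum]
  simp [Multiset.map_map]

end FHRing

theorem mainTheorem5 (Γ : Type*) [Group Γ] [Finite Γ] :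
    -- the structure constants of top degree do not depend on `n`
    (∀ lam mu nu : PartFn Γ, nu.degree = lam.degree + mu.degree →
      ∀ (n : ℕ) (z : Wreath Γ n), z.modifiedType = nu →
        (Wreath.classSum n lam * Wreath.classSum n mu).coeff z = FHRing.const lam mu nu) ∧
    -- the addition and multiplication of `FHRing Γ` are those of a commutative ring with unit
    ∃ R : CommRing (FHRing Γ),
      R.toNonUnitalCommRing.toNonUnitalNonAssocRing = FHRing.addMul Γ ∧
      -- triangularity of the monomials in the `K_{(r)_c}`
      (∀ lam : PartFn Γ, ∃ d : PartFn Γ →₀ ℕ,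
        (∀ mu ∈ d.support, lam ≤ mu) ∧ 0 < d lam ∧
        ∏ᶠ c : ConjClasses Γ, ((lam.part c).map fun r => FHRing.K (PartFn.single c r)).prod
          = d.sum fun mu a => a • FHRing.K mu) ∧
      -- algebraic independence over `ℤ`
      AlgebraicIndependent ℤ
        (fun p : ConjClasses Γ × ℕ+ => FHRing.K (PartFn.single p.1 p.2)) ∧
      -- `ℚ ⊗ FHRing Γ` is the polynomial ring in the `K_{(r)_c}`
      AlgebraicIndependent ℚ
        (fun p : ConjClasses Γ × ℕ+ => (1 : ℚ) ⊗ₜ[ℤ] FHRing.K (PartFn.single p.1 p.2)) ∧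
      Algebra.adjoin ℚ (Set.range
        (fun p : ConjClasses Γ × ℕ+ => (1 : ℚ) ⊗ₜ[ℤ] FHRing.K (PartFn.single p.1 p.2))) = ⊤ := by
  refine ⟨fun lam mu nu h n z hz => ?_, FHRing.commRing Γ, rfl, FHRing.exists_finprod_eq, ?_⟩
  · rw [Wreath.coeff_classSum_mul, FHRing.const_eq_numFact h hz]
  let := FHRing.commRing Γ
  have hZ : IsTriangular (FHRing.basis Γ) fun p => FHRing.K (PartFn.single p.1 p.2) :=
    FHRing.isTriangular_K
  -- Triangularity has natural coefficients, so it passes through the ring homomorphism `a ↦ 1 ⊗ a`,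
  -- which carries the basis to the base-changed one.
  have hQ : IsTriangular ((FHRing.basis Γ).baseChange ℚ)
      fun p => (1 : ℚ) ⊗ₜ[ℤ] FHRing.K (PartFn.single p.1 p.2) := by
    have := hZ.map (Algebra.TensorProduct.includeRight (R := ℤ) (A := ℚ)).toRingHom
    convert this using 1
    · ext lam
      exact Module.Basis.baseChange_apply _ _ _
    · rfl
  exact ⟨hZ.algebraicIndependent, hQ.algebraicIndependent, hQ.adjoin_eq_top⟩

end
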